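/- **Theorem (bounds involving distances from $X_3$).** For a nondegenerate triangle with side lengths $a,b,c$ (opposite the vertices $A,B,C$), let $X_n$ ($1\le n\le 10$) be the triangle center with barycentric coordinates $\bigl(f_n(a,b,c):f_n(b,c,a):f_n(c,a,b)\bigr)$, where $f_1=a$ (incenter), $f_2=1$ (centroid), $f_3=a^2(a^2-b^2-c^2)$ (circumcenter), $f_4=(a^2+b^2-c^2)(a^2-b^2+c^2)$ (orthocenter), $f_5=c^4-a^2b^2+b^4-a^2c^2-2b^2c^2$ (nine-point center), $f_6=a^2$ (symmedian point), $f_7=(a+b-c)(a-b+c)$ (Gergonne point), $f_8=a-b-c$ (Nagel point), $f_9=a(a-b-c)$ (mittenpunkt), $f_{10}=b+c$ (Spieker center), and let $D(i,j)$ be the distance between $X_i$ and $X_j$. Bounds $L\le \frac{D(3,i)}{D(3,j)}\le U$ are understood as $L\,D(3,j)\le D(3,i)\le U\,D(3,j)$ (for an equilateral triangle all these distances are $0$). Then the following bounds hold for all triangles in the Euclidean plane: $1\le\frac{D(3,1)}{D(3,2)}\le 3$; $\ \frac13\le\frac{D(3,1)}{D(3,4)}\le 1$; $\ \frac23\le\frac{D(3,1)}{D(3,5)}\le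 2$; $\ \sqrt3-1\le\frac{D(3,1)}{D(3,6)}\le 1$; $\ \frac{7+4\sqrt2}{17}\le\frac{D(3,1)}{D(3,7)}\le 1$; $\ 1\le\frac{D(3,1)}{D(3,8)}$; $\ 1\le\frac{D(3,1)}{D(3,9)}$; $\ 1\le\frac{D(3,1)}{D(3,10)}$; $\frac{D(3,2)}{D(3,4)}=\frac13$; $\ \frac{D(3,2)}{D(3,5)}=\frac23$; $\ \frac13\le\frac{D(3,2)}{D(3,6)}\le 1$; $\ \frac13\le\frac{D(3,2)}{D(3,7)}\le 1$; $\ \frac13\le\frac{D(3,2)}{D(3,8)}$; $\ 1\le\frac{D(3,2)}{D(3,9)}$; $\ 1\le\frac{D(3,2)}{D(3,10)}$; $\frac{D(3,4)}{D(3,5)}=2$; $\ 1\le\frac{D(3,4)}{D(3,6)}\le 3$; $\ 1\le\frac{D(3,4)}{D(3,7)}\le 3$; $\ 1\le\frac{D(3,4)}{D(3,8)}$; $\ 3\le\frac{D(3,4)}{D(3,9)}$; $\ 3\le\frac{D(3,4)}{D(3,10)}$; $\frac12\le\frac{D(3,5)}{D(3,6)}\le\frac32$; $\ \frac12\le\frac{D(3,5)}{D(3,7)}\le\frac32$;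 $\ \frac12\le\frac{D(3,5)}{D(3,8)}$; $\ \frac32\le\frac{D(3,5)}{D(3,9)}$; $\ \frac32\le\frac{D(3,5)}{D(3,10)}$; $C_1\le\frac{D(3,6)}{D(3,7)}\le C_2$; $\ 1\le\frac{D(3,6)}{D(3,8)}$; $\ 1\le\frac{D(3,6)}{D(3,9)}$; $\ 1\le\frac{D(3,6)}{D(3,10)}$; $1\le\frac{D(3,7)}{D(3,8)}$; $\ 1\le\frac{D(3,7)}{D(3,9)}$; $\ 1\le\frac{D(3,7)}{D(3,10)}$; $\ \frac12\le\frac{D(3,9)}{D(3,10)}\le 1$, where $C_2\approx 1.100851119$ (error less than $10^{-9}$) is the largest and $C_1\approx 0.9002270330$ (error less than $10^{-10}$) the second largest real root of $6137x^5-14689x^4+14429x^3-9547x^2+3698x-100$. Moreover, all these bounds are best possible: each lower bound is the largest constant $k$ with $k\,D(3,j)\le D(3,i)$ for all triangles, and each upper bound is the smallest constant $k$ with $D(3,i)\le k\,D(3,j)$ for all triangles. Where no upper bound is listed (including the unlisted ratios $D(3,8)/D(3,9)$ and $D(3,8)/D(3,10)$), there is no constant $k$ with $D(3,i)\le k\,D(3,j)$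 for all triangles; and for $D(3,8)/D(3,9)$ and $D(3,8)/D(3,10)$ there is no constant $k>0$ with $k\,D(3,j)\le D(3,i)$ for all triangles. -/

import Mathlib

namespace TriangleCenters

/-- The Euclidean plane. -/
abbrev Plane := EuclideanSpace ℝ (Fin 2)

/-- First barycentric coordinate `f(a,b,c)` of the triangle center `X_n`, `1 ≤ n ≤ 10`, as a function
of the side lengths `a, b, c`.  (Only the indices `1, …, 10` are used; other values are irrelevant.) -/
def firstCoord (n : ℕ) (a b c : ℝ) : ℝ :=
  match n with
  | 1 => a
  | 2 => 1
  | 3 => a ^ 2 * (a ^ 2 - b ^ 2 - c ^ 2)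
  | 4 => (a ^ 2 + b ^ 2 - c ^ 2) * (a ^ 2 - b ^ 2 + c ^ 2)
  | 5 => c ^ 4 - a ^ 2 * b ^ 2 + b ^ 4 - a ^ 2 * c ^ 2 - 2 * b ^ 2 * c ^ 2
  | 6 => a ^ 2
  | 7 => (a + b - c) * (a - b + c)
  | 8 => a - b - c
  | 9 => a * (a - b - c)
  | 10 => b + c
  | _ => 0

/-- The point of the plane with (homogeneous) barycentric coordinates `u : v : w` with respect to
the vertices of the triangle `T`. -/
noncomputable def baryPoint (T : Affine.Triangle ℝ Plane) (u v w : ℝ) : Plane :=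
  (u + v + w)⁻¹ • (u • T.points 0 + v • T.points 1 + w • T.points 2)

/-- The triangle center `X_n`: its barycentric coordinates are `f(a,b,c) : f(b,c,a) : f(c,a,b)`, where
`a = BC`, `b = CA`, `c = AB` are the side lengths of the (nondegenerate) triangle `T = ABC`. -/
noncomputable def center (T : Affine.Triangle ℝ Plane) (n : ℕ) : Plane :=
  let a := dist (T.points 1) (T.points 2)
  let b := dist (T.points 2) (T.points 0)
  let c := dist (T.points 0) (T.points 1)
  baryPoint T (firstCoord n a b c) (firstCoord n b c a) (firstCoord n c a b)

/-- `D T i j` is the distance between the centers `X_i` and `X_j` of the triangle `T`. -/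
noncomputable def D (T : Affine.Triangle ℝ Plane) (i j : ℕ) : ℝ :=
  dist (center T i) (center T j)

/-- `L ≤ D(n,i)/D(n,j)` is the best possible lower bound: `L` is the largest constant `k` such that
`k * D(n,j) ≤ D(n,i)` for all triangles.  (The inequality is cleared of denominators because both
distances vanish for an equilateral triangle.) -/
def BestLower (n i j : ℕ) (L : ℝ) : Prop :=
  IsGreatest {k : ℝ | ∀ T : Affine.Triangle ℝ Plane, k * D T n j ≤ D T n i} L

/-- `D(n,i)/D(n,j) ≤ U` is the best possible upper bound: `U` is the smallest constant `k` such that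
`D(n,i) ≤ k * D(n,j)` for all triangles. -/
def BestUpper (n i j : ℕ) (U : ℝ) : Prop :=
  IsLeast {k : ℝ | ∀ T : Affine.Triangle ℝ Plane, D T n i ≤ k * D T n j} U

/-- There is no constant `k` such that `D(n,i) ≤ k * D(n,j)` for all triangles. -/
def NoUpper (n i j : ℕ) : Prop :=
  ∀ k : ℝ, ∃ T : Affine.Triangle ℝ Plane, k * D T n j < D T n i

/-- Best possible two-sided bounds `L ≤ D(n,i)/D(n,j) ≤ U`. -/
def BestBounds (n i j : ℕ) (L U : ℝ) : Prop :=
  BestLower n i j L ∧ BestUpper n i j U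

/-- Best possible lower bound `L ≤ D(n,i)/D(n,j)`, and no finite upper bound. -/
def BestLowerOnly (n i j : ℕ) (L : ℝ) : Prop :=
  BestLower n i j L ∧ NoUpper n i j

/-- The quintic whose two largest real roots bound `D(3,6)/D(3,7)`. -/
def quintic (x : ℝ) : ℝ :=
  6137 * x ^ 5 - 14689 * x ^ 4 + 14429 * x ^ 3 - 9547 * x ^ 2 + 3698 * x - 100

end TriangleCenters

open TriangleCenters

namespace TriangleCenters

/-! Stewart's relation gives `D(3,n)^2` as `R^2` minus a symmetric function of the sides. In Ravi
variables, with sum `p`, second elementary symmetric function `q p^2 / 3` and product `t p^3 / 27`,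
all these squares share the factor `p^2 / (432 t)`, and what remains is the explicit function
`normSq n q t`. Every linear comparison of two distances thus becomes an inequality in two real
parameters. Put `q = 1 - δ^2`. The discriminant then says exactly that `t` lies between `(1 + δ)^2
(1 - 2δ)` and `(1 - δ)^2 (1 + 2δ)`. These ends are double roots, that is, isosceles triangles, for
which the centers lie on the axis and the distances are the one-variable functions `isoDist n s`
(`normSq_isosceles`).

The easy comparisons `9 ≤ 10 ≤ 2 ≤ 1 ≤ 6, 7` and `8 ≤ 1` follow from Schur-type inequalities. The
others (`6, 7 ≤ 3·2`, `10 ≤ 2·9` and the bounds with constants `√3 - 1`, `(7 + 4√2)/17`, `C₁`, `C₂`)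
are reduced to the isosceles ends by monotonicity or concavity in `t`, with a direct estimate where
a lower-end reduction is not used. The centers `X₄`, `X₅` lie on the Euler line, so their distances
are multiples of `D(3,2)`. All remaining bounds are obtained by combining these.

For optimality, a bound valid for all triangles passes by continuity to every `s` in `[0, 1]`,
including degenerate shapes and the equilateral limit `s = 1/2` (`isoDist_le_of_forall`). Evaluation
at one well-chosen `s` then forces the constant, except for `9/10`, whose extremal shape `s = 0`
gives `0/0`. For `6/7` the extremal shapes are critical points of a rational function, and the
quintic is satisfied by its critical values. -/

theorem dist_sq_plane (P Q : Plane) : dist P Q ^ 2 = (P 0 - Q 0) ^ 2 + (P 1 - Q 1) ^ 2 := by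
  rw [EuclideanSpace.dist_eq, Real.sq_sqrt (by positivity), Fin.sum_univ_two, Real.dist_eq,
    Real.dist_eq, sq_abs, sq_abs]

theorem baryPoint_apply (T : Affine.Triangle ℝ Plane) (u v w : ℝ) (i : Fin 2) :
    baryPoint T u v w i =
      (u + v + w)⁻¹ * (u * T.points 0 i + v * T.points 1 i + w * T.points 2 i) := by
  simp [baryPoint]
  ring

/-! ### Distances from the circumcenter in Ravi variables -/

/-- Stewart's relation: the distance from any point to a point given by barycentric coordinates. -/
theorem dist_baryPoint_sq (T : Affine.Triangle ℝ Plane) (P : Plane) {u v w : ℝ}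
    (h : u + v + w ≠ 0) :
    dist P (baryPoint T u v w) ^ 2 =
      (u * dist P (T.points 0) ^ 2 + v * dist P (T.points 1) ^ 2 + w * dist P (T.points 2) ^ 2)
          / (u + v + w)
        - (dist (T.points 1) (T.points 2) ^ 2 * (v * w) + dist (T.points 2) (T.points 0) ^ 2 * (w * u)
          + dist (T.points 0) (T.points 1) ^ 2 * (u * v)) / (u + v + w) ^ 2 := by
  simp only [dist_sq_plane, baryPoint_apply]
  field_simp
  ring

/-- The Ravi substitution. -/
theorem exists_ravi (T : Affine.Triangle ℝ Plane) : ∃ x y z : ℝ, 0 < x ∧ 0 < y ∧ 0 < z ∧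
    dist (T.points 1) (T.points 2) = y + z ∧ dist (T.points 2) (T.points 0) = z + x ∧
    dist (T.points 0) (T.points 1) = x + y := by
  have key : ∀ i j k : Fin 3, i ≠ j → i ≠ k → j ≠ k →
      dist (T.points i) (T.points k) < dist (T.points i) (T.points j) +
        dist (T.points j) (T.points k) := by
    intro i j k hij hik hjk
    refine lt_of_le_of_ne (dist_triangle _ _ _) fun h => ?_
    have hw : Wbtw ℝ (T.points i) (T.points j) (T.points k) := dist_add_dist_eq_iff.1 h.symm
    exact affineIndependent_iff_not_collinear_of_ne hij hik hjk |>.1 T.independent hw.collinear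
  have h1 := key 1 0 2 (by decide) (by decide) (by decide)
  have h2 := key 0 1 2 (by decide) (by decide) (by decide)
  have h3 := key 0 2 1 (by decide) (by decide) (by decide)
  rw [dist_comm (T.points 1) (T.points 0), dist_comm (T.points 0) (T.points 2)] at h1
  rw [dist_comm (T.points 0) (T.points 2)] at h2
  rw [dist_comm (T.points 0) (T.points 2), dist_comm (T.points 2) (T.points 1)] at h3
  set a := dist (T.points 1) (T.points 2)
  set b := dist (T.points 2) (T.points 0)
  set c := dist (T.points 0) (T.points 1)
  exact ⟨(b + c - a) / 2, (c + a - b) / 2, (a + b - c) / 2, by linarith, by linarith, by linarith,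
    by ring, by ring, by ring⟩

/-- The power of the center `X_n` with respect to the circumcircle, in barycentric coordinates. -/
theorem dist_center_three_sq (T : Affine.Triangle ℝ Plane) {x y z u v w : ℝ}
    (hx : 0 < x) (hy : 0 < y) (hz : 0 < z)
    (ha : dist (T.points 1) (T.points 2) = y + z) (hb : dist (T.points 2) (T.points 0) = z + x)
    (hc : dist (T.points 0) (T.points 1) = x + y) (h : u + v + w ≠ 0) :
    dist (center T 3) (baryPoint T u v w) ^ 2 =
      ((y + z) * (z + x) * (x + y)) ^ 2 / (16 * (x + y + z) * (x * y * z))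
        - ((y + z) ^ 2 * (v * w) + (z + x) ^ 2 * (w * u) + (x + y) ^ 2 * (u * v))
          / (u + v + w) ^ 2 := by
  have hE : 16 * (x + y + z) * (x * y * z) ≠ 0 := by positivity
  have hs : firstCoord 3 (y + z) (z + x) (x + y) + firstCoord 3 (z + x) (x + y) (y + z)
      + firstCoord 3 (x + y) (y + z) (z + x) = - (16 * (x + y + z) * (x * y * z)) := by
    simp only [firstCoord]; ring
  have hs0 := hs.trans_ne (neg_ne_zero.2 hE)
  -- The circumcenter is at distance `R = abc / (4 · area)` from each vertex, with Heron's formula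
  -- in the denominator. In Stewart's relation the three vertex terms then collapse to `R^2`.
  have hR : ∀ i, dist (center T 3) (T.points i) ^ 2 =
      ((y + z) * (z + x) * (x + y)) ^ 2 / (16 * (x + y + z) * (x * y * z)) := by
    intro i
    rw [dist_comm]
    simp only [center, ha, hb, hc]
    rw [dist_baryPoint_sq T _ hs0, hs, ha, hb, hc]
    fin_cases i
    · simp only [Fin.zero_eta, dist_self, dist_comm (T.points 0) (T.points 2), hb, hc, firstCoord]
      field_simp
      ring
    · simp only [Fin.mk_one, dist_self, dist_comm (T.points 1) (T.points 0), ha, hc, firstCoord]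
      field_simp
      ring
    · simp only [Fin.reduceFinMk, dist_self, dist_comm (T.points 2) (T.points 1), ha, hb,
        firstCoord]
      field_simp
      ring
  rw [dist_baryPoint_sq T _ h, hR, hR, hR, ha, hb, hc, ← add_mul, ← add_mul,
    mul_div_cancel_left₀ _ h]

/-! ### Normalized symmetric functions and the region they fill -/

/-- The square of `D(3,n)`, up to a factor common to all `n`, in terms of the normalized elementary
symmetric functions `q`, `t` of the Ravi variables. -/
noncomputable def normSq (n : ℕ) (q t : ℝ) : ℝ :=
  match n with
  | 1 => 9 * (9 * q - t) * (q - t)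
  | 2 => (9 * q - t) ^ 2 - 32 * t * (3 - q)
  | 6 => (9 * q - t) ^ 2 * (1 - 4 * t / (3 - q) ^ 2)
  | 7 => (9 * q - t) ^ 2 - 16 * t ^ 2 * (3 * q + t) / q ^ 2
  | 8 => 81 * (q - t) ^ 2
  | 9 => (9 * q - t) ^ 2 - 4 * t * (9 * q - t) * (3 * q - t) / q ^ 2
  | 10 => (9 * q - t) ^ 2 - 36 * t * (3 - q) + 8 * t ^ 2
  | _ => 0

/-- The values of `(δ, t)` coming from triangles: with `q = 1 - δ ^ 2`, the polynomial with
elementary symmetric functions `1`, `q / 3`, `t / 27` has three positive real roots. -/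
structure Region (δ t : ℝ) : Prop where
  nonneg : 0 ≤ δ
  lt_one : δ < 1
  pos : 0 < t
  lower : (1 + δ) ^ 2 * (1 - 2 * δ) ≤ t
  upper : t ≤ (1 - δ) ^ 2 * (1 + 2 * δ)

theorem exists_region {x y z : ℝ} (hx : 0 < x) (hy : 0 < y) (hz : 0 < z) :
    ∃ δ t : ℝ, Region δ t ∧ 3 * (x * y + y * z + z * x) = (1 - δ ^ 2) * (x + y + z) ^ 2 ∧
      27 * (x * y * z) = t * (x + y + z) ^ 3 := by
  have hp : 0 < x + y + z := by positivity
  have hq : 0 < x * y + y * z + z * x := by positivity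
  obtain ⟨p, hpd⟩ : ∃ p, p = x + y + z := ⟨_, rfl⟩
  obtain ⟨q, hqd⟩ : ∃ q, q = x * y + y * z + z * x := ⟨_, rfl⟩
  obtain ⟨w, hwd⟩ : ∃ w, w = x * y * z := ⟨_, rfl⟩
  have hw : 0 < w := by rw [hwd]; positivity
  have hdisc : 0 ≤ p ^ 2 * q ^ 2 - 4 * q ^ 3 - 4 * p ^ 3 * w + 18 * p * q * w - 27 * w ^ 2 := by
    have : p ^ 2 * q ^ 2 - 4 * q ^ 3 - 4 * p ^ 3 * w + 18 * p * q * w - 27 * w ^ 2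
        = ((x - y) * (y - z) * (z - x)) ^ 2 := by rw [hpd, hqd, hwd]; ring
    rw [this]; positivity
  have hle : 3 * q ≤ p ^ 2 := by
    rw [hpd, hqd]; nlinarith [sq_nonneg (x - y), sq_nonneg (y - z), sq_nonneg (z - x)]
  rw [← hpd] at hp ⊢
  rw [← hqd] at hq ⊢
  rw [← hwd]
  have hδ : 0 ≤ 1 - 3 * q / p ^ 2 := by
    rw [sub_nonneg, div_le_one (by positivity)]; exact hle
  have hsq := Real.sq_sqrt hδ
  have h0 := Real.sqrt_nonneg (1 - 3 * q / p ^ 2)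
  set δ := √(1 - 3 * q / p ^ 2)
  have hq' : 3 * q = (1 - δ ^ 2) * p ^ 2 := by rw [hsq]; field_simp; ring
  have hδ1 : δ < 1 := by
    have : 0 < 3 * q / p ^ 2 := by positivity
    nlinarith
  obtain ⟨t, htd⟩ : ∃ t, t = 27 * w / p ^ 3 := ⟨_, rfl⟩
  have ht : 27 * w = t * p ^ 3 := by rw [htd]; field_simp
  have ht0 : 0 < t := by rw [htd]; positivity
  -- In terms of `δ` and `t` the discriminant is `p^6 / 27` times this product, so `t` lies between
  -- the two double-root values.
  have hprod : 0 ≤ (t - (1 + δ) ^ 2 * (1 - 2 * δ)) * ((1 - δ) ^ 2 * (1 + 2 * δ) - t) := by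
    have hqe : q = (1 - δ ^ 2) * p ^ 2 / 3 := by linarith
    have hwe : w = t * p ^ 3 / 27 := by linarith
    rw [hqe, hwe] at hdisc
    have : 0 ≤ p ^ 6 * ((t - (1 + δ) ^ 2 * (1 - 2 * δ)) * ((1 - δ) ^ 2 * (1 + 2 * δ) - t)) := by
      nlinarith
    exact nonneg_of_mul_nonneg_right this (by positivity)
  have hord : (1 + δ) ^ 2 * (1 - 2 * δ) ≤ (1 - δ) ^ 2 * (1 + 2 * δ) := by
    nlinarith [pow_nonneg h0 3]
  refine ⟨δ, t, ⟨h0, hδ1, ht0, ?_, ?_⟩, hq', ht⟩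
  · by_contra! hlt
    nlinarith [mul_pos (sub_pos.2 hlt) (sub_pos.2 (hlt.trans_le hord))]
  · by_contra! hlt
    nlinarith [mul_pos (sub_pos.2 hlt) (sub_pos.2 (hord.trans_lt hlt))]

theorem exists_normSq (T : Affine.Triangle ℝ Plane) : ∃ δ t l : ℝ, Region δ t ∧ 0 < l ∧
    ∀ n ∈ ({1, 2, 6, 7, 8, 9, 10} : Set ℕ), D T 3 n ^ 2 = l * normSq n (1 - δ ^ 2) t := by
  obtain ⟨x, y, z, hx, hy, hz, ha, hb, hc⟩ := exists_ravi T
  obtain ⟨δ, t, hr, hq, ht⟩ := exists_region hx hy hz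
  have hδ : 0 < 1 - δ ^ 2 := by nlinarith [hr.nonneg, hr.lt_one]
  have ht0 := hr.pos
  have hq' : x * y + y * z + z * x = (1 - δ ^ 2) * (x + y + z) ^ 2 / 3 := by linarith
  have ht' : x * y * z = t * (x + y + z) ^ 3 / 27 := by linarith
  have hp : 0 < x + y + z := by positivity
  obtain ⟨p, hpd⟩ : ∃ p, p = x + y + z := ⟨_, rfl⟩
  obtain ⟨Q, hQd⟩ : ∃ Q, Q = 1 - δ ^ 2 := ⟨_, rfl⟩
  rw [← hpd, ← hQd] at hq'
  rw [← hpd] at ht' hp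
  rw [← hQd] at hδ
  have hQ3 : 0 < 3 - Q := by rw [hQd]; nlinarith [sq_nonneg δ]
  have hm : (y + z) * (z + x) * (x + y) = Q * p ^ 2 / 3 * p - t * p ^ 3 / 27 := by
    rw [← hq', ← ht', hpd]; ring
  refine ⟨δ, t, p ^ 2 / (432 * t), hr, by positivity, ?_⟩
  rw [← hQd]
  have main : ∀ n (s v : ℝ), s ≠ 0 → firstCoord n (y + z) (z + x) (x + y) +
      firstCoord n (z + x) (x + y) (y + z) + firstCoord n (x + y) (y + z) (z + x) = s →
      (y + z) ^ 2 * (firstCoord n (z + x) (x + y) (y + z) * firstCoord n (x + y) (y + z) (z + x)) +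
      (z + x) ^ 2 * (firstCoord n (x + y) (y + z) (z + x) * firstCoord n (y + z) (z + x) (x + y)) +
      (x + y) ^ 2 * (firstCoord n (y + z) (z + x) (x + y) * firstCoord n (z + x) (x + y) (y + z))
       = v →
      D T 3 n ^ 2 = (Q * p ^ 2 / 3 * p - t * p ^ 3 / 27) ^ 2 / (16 * p * (t * p ^ 3 / 27))
        - v / s ^ 2 := by
    intro n s v hs0 hs hv
    have hc' : center T n = baryPoint T (firstCoord n (y + z) (z + x) (x + y))
      (firstCoord n (z + x) (x + y) (y + z)) (firstCoord n (x + y) (y + z) (z + x)) := by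
      rw [center, ha, hb, hc]
    rw [D, hc', dist_center_three_sq T hx hy hz ha hb hc (hs.trans_ne hs0), hs, hv, hm, ← hpd, ht']
  intro n hn
  simp only [Set.mem_insert_iff, Set.mem_singleton_iff] at hn
  rcases hn with rfl | rfl | rfl | rfl | rfl | rfl | rfl
  · rw [main 1 (2 * p) (2 * p * (Q * p ^ 2 / 3 * p - t * p ^ 3 / 27)) (by positivity)
      (by simp only [firstCoord]; rw [hpd]; ring)
      (by rw [← hm]; simp only [firstCoord]; rw [hpd]; ring)]
    simp only [normSq]; field_simp; ring
  · rw [main 2 3 (2 * p ^ 2 - 2 * (Q * p ^ 2 / 3)) (by positivity)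
      (by simp only [firstCoord]; norm_num)
      (by rw [← hq']; simp only [firstCoord]; rw [hpd]; ring)]
    simp only [normSq]; field_simp; ring
  · rw [main 6 (2 * p ^ 2 - 2 * (Q * p ^ 2 / 3)) (3 * (Q * p ^ 2 / 3 * p - t * p ^ 3 / 27) ^ 2)
      (by have : 2 * p ^ 2 - 2 * (Q * p ^ 2 / 3) = 2 / 3 * p ^ 2 * (3 - Q) := by ring
          rw [this]; positivity)
      (by rw [← hq']; simp only [firstCoord]; rw [hpd]; ring)
      (by rw [← hm]; simp only [firstCoord]; ring)]
    have : 2 * p ^ 2 - 2 * (Q * p ^ 2 / 3) = 2 / 3 * p ^ 2 * (3 - Q) := by ring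
    rw [this]
    simp only [normSq]; field_simp; ring
  · rw [main 7 (4 * (Q * p ^ 2 / 3))
      (16 * (t * p ^ 3 / 27 * (p * (Q * p ^ 2 / 3) + 3 * (t * p ^ 3 / 27)))) (by positivity)
      (by rw [← hq']; simp only [firstCoord]; ring)
      (by rw [← hq', ← ht']; simp only [firstCoord]; rw [hpd]; ring)]
    simp only [normSq]; field_simp; ring
  · rw [main 8 (-(2 * p)) (4 * (p ^ 2 * (Q * p ^ 2 / 3) - 5 * p * (t * p ^ 3 / 27)))
      (neg_ne_zero.2 (by positivity))
      (by simp only [firstCoord]; rw [hpd]; ring)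
      (by rw [← hq', ← ht']; simp only [firstCoord]; rw [hpd]; ring)]
    simp only [normSq]; field_simp; ring
  · rw [main 9 (-(4 * (Q * p ^ 2 / 3)))
      (4 * ((Q * p ^ 2 / 3 * p - t * p ^ 3 / 27) * (p * (Q * p ^ 2 / 3) - 3 * (t * p ^ 3 / 27))))
      (neg_ne_zero.2 (by positivity))
      (by rw [← hq']; simp only [firstCoord]; ring)
      (by rw [← hm, ← hq', ← ht']; simp only [firstCoord]; rw [hpd]; ring)]
    simp only [normSq]; field_simp; ring
  · rw [main 10 (4 * p)
      (4 * p ^ 4 - 4 * p ^ 2 * (Q * p ^ 2 / 3) - 8 * p * (t * p ^ 3 / 27)) (by positivity)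
      (by simp only [firstCoord]; rw [hpd]; ring)
      (by rw [← hq', ← ht']; simp only [firstCoord]; rw [hpd]; ring)]
    simp only [normSq]; field_simp; ring

/-! ### The Euler line -/

theorem center_four_five (T : Affine.Triangle ℝ Plane) :
    center T 4 = (3 : ℝ) • center T 2 - (2 : ℝ) • center T 3 ∧
    center T 5 = (3 / 2 : ℝ) • center T 2 - (1 / 2 : ℝ) • center T 3 := by
  obtain ⟨x, y, z, hx, hy, hz, ha, hb, hc⟩ := exists_ravi T
  obtain ⟨E, hE⟩ : ∃ E, E = 16 * (x + y + z) * (x * y * z) := ⟨_, rfl⟩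
  have hE0 : E ≠ 0 := by rw [hE]; positivity
  have h2 : firstCoord 2 (y + z) (z + x) (x + y) + firstCoord 2 (z + x) (x + y) (y + z)
      + firstCoord 2 (x + y) (y + z) (z + x) = 3 := by
    simp only [firstCoord]; norm_num
  have h3 : firstCoord 3 (y + z) (z + x) (x + y) + firstCoord 3 (z + x) (x + y) (y + z)
      + firstCoord 3 (x + y) (y + z) (z + x) = - E := by
    simp only [firstCoord]; rw [hE]; ring
  have h4 : firstCoord 4 (y + z) (z + x) (x + y) + firstCoord 4 (z + x) (x + y) (y + z)
      + firstCoord 4 (x + y) (y + z) (z + x) = E := by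
    simp only [firstCoord]; rw [hE]; ring
  have h5 : firstCoord 5 (y + z) (z + x) (x + y) + firstCoord 5 (z + x) (x + y) (y + z)
      + firstCoord 5 (x + y) (y + z) (z + x) = - (2 * E) := by
    simp only [firstCoord]; rw [hE]; ring
  constructor
  · ext i
    simp only [center, ha, hb, hc, PiLp.sub_apply, PiLp.smul_apply, smul_eq_mul, baryPoint_apply,
      h2, h3, h4]
    field_simp
    simp only [firstCoord]
    rw [hE]
    ring
  · ext i
    simp only [center, ha, hb, hc, PiLp.sub_apply, PiLp.smul_apply, smul_eq_mul, baryPoint_apply,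
      h2, h3, h5]
    field_simp
    simp only [firstCoord]
    rw [hE]
    ring

theorem D_three_four (T : Affine.Triangle ℝ Plane) : D T 3 4 = 3 * D T 3 2 := by
  have h : center T 3 - center T 4 = (3 : ℝ) • (center T 3 - center T 2) := by
    rw [(center_four_five T).1]; module
  rw [D, D, dist_eq_norm, dist_eq_norm, h, norm_smul]
  norm_num

theorem D_three_five (T : Affine.Triangle ℝ Plane) : D T 3 5 = 3 / 2 * D T 3 2 := by
  have h : center T 3 - center T 5 = (3 / 2 : ℝ) • (center T 3 - center T 2) := by
    rw [(center_four_five T).2]; module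
  rw [D, D, dist_eq_norm, dist_eq_norm, h, norm_smul]
  norm_num

/-! ### The isosceles family -/

theorem exists_isosceles {s : ℝ} (h0 : 0 < s) (h1 : s < 1) : ∃ T : Affine.Triangle ℝ Plane,
    T.points 0 = !₂[-s, 0] ∧ T.points 1 = !₂[s, 0] ∧ T.points 2 = !₂[0, √(1 - s ^ 2)] ∧
    dist (T.points 1) (T.points 2) = 1 ∧ dist (T.points 2) (T.points 0) = 1 ∧
    dist (T.points 0) (T.points 1) = 2 * s := by
  have hs : 0 < 1 - s ^ 2 := by nlinarith
  have hh := Real.sqrt_pos.2 hs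
  have hsq := Real.sq_sqrt hs.le
  set h := √(1 - s ^ 2)
  have hind : AffineIndependent ℝ (![!₂[-s, 0], !₂[s, 0], !₂[0, h]] : Fin 3 → Plane) := by
    rw [affineIndependent_iff_of_fintype]
    intro w hw hv
    rw [Finset.weightedVSub_eq_linear_combination _ hw] at hv
    have e0 := congrArg (fun v : Plane => v 0) hv
    have e1 := congrArg (fun v : Plane => v 1) hv
    simp [Fin.sum_univ_three] at e0 e1 hw
    have w2 : w 2 = 0 := by
      rcases e1 with h' | h'
      · exact h'
      · exact absurd h' hh.ne'
    have w01 : w 1 = w 0 := by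
      have : s * (w 1 - w 0) = 0 := by linarith
      rcases mul_eq_zero.1 this with h' | h'
      · exact absurd h' h0.ne'
      · linarith
    intro i
    fin_cases i
    · simp; linarith
    · simp; linarith
    · simpa using w2
  refine ⟨⟨_, hind⟩, rfl, rfl, rfl, ?_, ?_, ?_⟩
  · refine (sq_eq_sq₀ dist_nonneg one_pos.le).1 ?_
    rw [dist_sq_plane]; simp [hsq]
  · refine (sq_eq_sq₀ dist_nonneg one_pos.le).1 ?_
    rw [dist_sq_plane]; simp [hsq]
  · refine (sq_eq_sq₀ dist_nonneg (by positivity)).1 ?_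
    rw [dist_sq_plane]; simp; ring

/-- `D(3,n)`, up to a factor common to all `n`, for an isosceles triangle with legs `1` and base
`2 * s`. -/
noncomputable def isoDist (n : ℕ) (s : ℝ) : ℝ :=
  match n with
  | 1 => 1
  | 2 => (1 + 2 * s) / 3
  | 4 => 1 + 2 * s
  | 5 => (1 + 2 * s) / 2
  | 6 => (1 + 2 * s) / (1 + 2 * s ^ 2)
  | 7 => (2 + s - 2 * s ^ 2) / (2 - s)
  | 8 => |1 - 2 * s|
  | 9 => s / (2 - s)
  | 10 => s
  | _ => 0

/-- All distances from `X₃` along the axis carry the factor `1 - 2s`. Dividing it out, which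
requires `s ≠ 1/2`, leaves functions that still carry information in the equilateral limit. -/
theorem exists_isoDist {s : ℝ} (h0 : 0 < s) (h1 : s < 1) (hs : s ≠ 1 / 2) :
    ∃ (T : Affine.Triangle ℝ Plane) (l : ℝ), 0 < l ∧
      ∀ n ∈ ({1, 2, 4, 5, 6, 7, 8, 9, 10} : Set ℕ), D T 3 n = l * isoDist n s := by
  obtain ⟨T, p0, p1, p2, ha, hb, hc⟩ := exists_isosceles h0 h1
  have hs2 : 0 < 1 - s ^ 2 := by nlinarith
  have hh := Real.sqrt_pos.2 hs2
  set h := √(1 - s ^ 2)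
  have hl : 0 < |1 - 2 * s| := abs_pos.2 fun h => hs (by linarith)
  have hs' : 0 < 2 - s := by linarith
  refine ⟨T, h * |1 - 2 * s| / (2 * (1 - s ^ 2)), by positivity, ?_⟩
  have h3 : center T 3 = !₂[0, h * ((1 - 2 * s ^ 2) / (2 * (1 - s ^ 2)))] := by
    have e : firstCoord 3 1 1 (2 * s) + firstCoord 3 1 (2 * s) 1 + firstCoord 3 (2 * s) 1 1 =
        - (16 * s ^ 2 * (1 - s ^ 2)) := by simp only [firstCoord]; ring
    ext i
    simp only [center, ha, hb, hc, baryPoint_apply, e]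
    simp only [p0, p1, p2]
    fin_cases i
    · simp [firstCoord]
    · simp [firstCoord]; field_simp; ring
  have main : ∀ n (r e : ℝ), firstCoord n 1 1 (2 * s) = firstCoord n 1 (2 * s) 1 →
      firstCoord n 1 1 (2 * s) + firstCoord n 1 (2 * s) 1 + firstCoord n (2 * s) 1 1 = r → r ≠ 0 →
      (1 - 2 * s ^ 2) / (2 * (1 - s ^ 2)) - r⁻¹ * firstCoord n (2 * s) 1 1 =
        (1 - 2 * s) / (2 * (1 - s ^ 2)) * e →
      D T 3 n = h * |1 - 2 * s| / (2 * (1 - s ^ 2)) * |e| := by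
    intro n r e hsym hr hr0 he
    have hn : center T n = !₂[0, h * (r⁻¹ * firstCoord n (2 * s) 1 1)] := by
      ext i
      simp only [center, ha, hb, hc, baryPoint_apply, hr]
      simp only [p0, p1, p2]
      fin_cases i
      · simp [hsym]
      · simp; ring
    have hz : 0 ≤ h * |1 - 2 * s| / (2 * (1 - s ^ 2)) * |e| := by positivity
    refine (sq_eq_sq₀ dist_nonneg hz).1 ?_
    rw [h3, hn, dist_sq_plane]
    simp only [Matrix.cons_val_zero, Matrix.cons_val_one]
    rw [← mul_sub, he]
    simp only [mul_pow, div_pow, sq_abs]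
    ring
  have main' : ∀ n (r e : ℝ), firstCoord n 1 1 (2 * s) = firstCoord n 1 (2 * s) 1 →
      firstCoord n 1 1 (2 * s) + firstCoord n 1 (2 * s) 1 + firstCoord n (2 * s) 1 1 = r → r ≠ 0 →
      0 < e → (1 - 2 * s ^ 2) / (2 * (1 - s ^ 2)) - r⁻¹ * firstCoord n (2 * s) 1 1 =
        (1 - 2 * s) / (2 * (1 - s ^ 2)) * e →
      D T 3 n = h * |1 - 2 * s| / (2 * (1 - s ^ 2)) * e := by
    intro n r e hsym hr hr0 he he'
    rw [main n r e hsym hr hr0 he', abs_of_pos he]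
  have m2 : D T 3 2 = h * |1 - 2 * s| / (2 * (1 - s ^ 2)) * isoDist 2 s := by
    rw [main' 2 3 ((1 + 2 * s) / 3) (by simp only [firstCoord])
      (by simp only [firstCoord]; norm_num) (by norm_num)
      (by positivity) (by simp only [firstCoord]; field_simp; ring)]
    simp only [isoDist]
  intro n hn
  simp only [Set.mem_insert_iff, Set.mem_singleton_iff] at hn
  rcases hn with rfl | rfl | rfl | rfl | rfl | rfl | rfl | rfl | rfl
  · rw [main 1 (2 + 2 * s) 1 (by simp only [firstCoord])
      (by simp only [firstCoord]; ring) (by positivity)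
      (by simp only [firstCoord]; field_simp; ring)]
    simp only [isoDist, abs_one]
  · exact m2
  · rw [D_three_four, m2]; simp only [isoDist]; ring
  · rw [D_three_five, m2]; simp only [isoDist]; ring
  · rw [main' 6 (2 + 4 * s ^ 2) ((1 + 2 * s) / (1 + 2 * s ^ 2)) (by simp only [firstCoord])
      (by simp only [firstCoord]; ring) (by positivity)
      (by positivity) (by simp only [firstCoord]; field_simp; ring)]
    simp only [isoDist]
  · have h7 : 0 < 2 + s - 2 * s ^ 2 := by nlinarith
    rw [main' 7 (4 * s * (2 - s)) ((2 + s - 2 * s ^ 2) / (2 - s)) (by simp only [firstCoord]; ring)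
      (by simp only [firstCoord]; ring) (by positivity)
      (by positivity) (by simp only [firstCoord]; field_simp; ring)]
    simp only [isoDist]
  · rw [main 8 (- (2 + 2 * s)) (-(1 - 2 * s)) (by simp only [firstCoord]; ring)
      (by simp only [firstCoord]; ring) (neg_ne_zero.2 (by positivity))
      (by simp only [firstCoord]; field_simp; ring), abs_neg]
    simp only [isoDist]
  · rw [main' 9 (-(4 * s * (2 - s))) (s / (2 - s)) (by simp only [firstCoord]; ring)
      (by simp only [firstCoord]; ring) (neg_ne_zero.2 (by positivity))
      (by positivity) (by simp only [firstCoord]; field_simp; ring)]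
    simp only [isoDist]
  · rw [main' 10 (4 + 4 * s) s (by simp only [firstCoord]; ring)
      (by simp only [firstCoord]; ring) (by positivity)
      (by positivity) (by simp only [firstCoord]; field_simp; ring)]
    simp only [isoDist]

theorem continuousOn_isoDist (n : ℕ) : ContinuousOn (isoDist n) (Set.Icc 0 1) := by
  have h2 : ∀ s ∈ Set.Icc (0 : ℝ) 1, 2 - s ≠ 0 := fun s hs => by linarith [hs.2]
  have h6 : ∀ s ∈ Set.Icc (0 : ℝ) 1, 1 + 2 * s ^ 2 ≠ 0 := fun s hs => by positivity
  unfold isoDist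
  split <;> fun_prop (disch := assumption)

/-- A linear inequality between distances from `X_3` that holds for all triangles passes to all
isosceles shapes, degenerate ones included. -/
theorem isoDist_le_of_forall {i j : ℕ} (hi : i ∈ ({1, 2, 4, 5, 6, 7, 8, 9, 10} : Set ℕ))
    (hj : j ∈ ({1, 2, 4, 5, 6, 7, 8, 9, 10} : Set ℕ)) {k m : ℝ}
    (h : ∀ T : Affine.Triangle ℝ Plane, k * D T 3 j ≤ m * D T 3 i) {s : ℝ}
    (hs : s ∈ Set.Icc (0 : ℝ) 1) : k * isoDist j s ≤ m * isoDist i s := by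
  have hsub : Set.Icc (0 : ℝ) 1 ⊆ closure (Set.Ioo (0 : ℝ) 1 ∩ {1 / 2}ᶜ) := by
    rw [← closure_Ioo zero_ne_one]
    exact closure_minimal ((dense_compl_singleton (1 / 2 : ℝ)).open_subset_closure_inter isOpen_Ioo)
      isClosed_closure
  refine ContinuousWithinAt.closure_le (hsub hs)
    (f := fun s => k * isoDist j s) (g := fun s => m * isoDist i s) ?_ ?_ ?_
  · exact ((continuousOn_isoDist j s hs).mono (fun x hx => ⟨hx.1.1.le, hx.1.2.le⟩)).const_mul k
  · exact ((continuousOn_isoDist i s hs).mono (fun x hx => ⟨hx.1.1.le, hx.1.2.le⟩)).const_mul m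
  · rintro x ⟨hx, hx'⟩
    obtain ⟨T, l, hl, hT⟩ := exists_isoDist hx.1 hx.2 hx'
    have := h T
    rw [hT i hi, hT j hj] at this
    refine le_of_mul_le_mul_left ?_ hl
    linarith

theorem isoDist_nonneg (n : ℕ) {s : ℝ} (h0 : 0 ≤ s) (h1 : s ≤ 1) : 0 ≤ isoDist n s := by
  have h2 : 0 ≤ 2 - s := by linarith
  have h7 : 0 ≤ 2 + s - 2 * s ^ 2 := by nlinarith
  unfold isoDist
  split <;> positivity

/-- Ravi variables with sum 3 and a double value are `1 - δ, 1 - δ, 1 + 2δ`; scaling the legs to 1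
gives `s = (1 - δ)/(2 + δ)`. Negative `δ` is allowed so that the lower end of the region is covered
by `-δ`. -/
theorem normSq_isosceles {n : ℕ} (hn : n ∈ ({1, 2, 6, 7, 8, 9, 10} : Set ℕ)) {δ : ℝ} (h0 : -1 < δ)
    (h1 : δ < 1) : normSq n (1 - δ ^ 2) ((1 - δ) ^ 2 * (1 + 2 * δ)) =
      (6 * (1 - δ) * (2 + δ) * δ) ^ 2 * isoDist n ((1 - δ) / (2 + δ)) ^ 2 := by
  have a1 : 0 < 1 - δ := by linarith
  have a2 : 0 < 1 + δ := by linarith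
  have a3 : 0 < 2 + δ := by linarith
  have hq : 1 - δ ^ 2 = (1 - δ) * (1 + δ) := by ring
  have hs : 2 - (1 - δ) / (2 + δ) = 3 * (1 + δ) / (2 + δ) := by field_simp; ring
  have hS : 1 + 2 * ((1 - δ) / (2 + δ)) ^ 2 = 3 * (2 + δ ^ 2) / (2 + δ) ^ 2 := by
    field_simp; ring
  have h3 : 3 - (1 - δ ^ 2) = 2 + δ ^ 2 := by ring
  simp only [Set.mem_insert_iff, Set.mem_singleton_iff] at hn
  rcases hn with rfl | rfl | rfl | rfl | rfl | rfl | rfl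
  · simp only [normSq, isoDist]; ring
  · simp only [normSq, isoDist]; field_simp; ring
  · simp only [normSq, isoDist]; rw [hS, h3]; field_simp; ring
  · simp only [normSq, isoDist]; rw [hs, hq]; field_simp; ring
  · simp only [normSq, isoDist, sq_abs]; field_simp; ring
  · simp only [normSq, isoDist]; rw [hs, hq]; field_simp; ring
  · simp only [normSq, isoDist]; field_simp; ring

theorem normSq_isosceles_le {i j : ℕ} (hi : i ∈ ({1, 2, 6, 7, 8, 9, 10} : Set ℕ))
    (hj : j ∈ ({1, 2, 6, 7, 8, 9, 10} : Set ℕ)) {k m : ℝ} (hk : 0 ≤ k)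
    (h : ∀ s, 0 ≤ s → s ≤ 1 → k * isoDist j s ≤ m * isoDist i s) {δ : ℝ} (h0 : -(1 / 2) ≤ δ)
    (h1 : δ < 1) : k ^ 2 * normSq j (1 - δ ^ 2) ((1 - δ) ^ 2 * (1 + 2 * δ)) ≤
      m ^ 2 * normSq i (1 - δ ^ 2) ((1 - δ) ^ 2 * (1 + 2 * δ)) := by
  rw [normSq_isosceles hi (by linarith) h1, normSq_isosceles hj (by linarith) h1]
  have a1 : 0 < 1 - δ := by linarith
  have a3 : 0 < 2 + δ := by linarith
  have hs0 : 0 ≤ (1 - δ) / (2 + δ) := by positivity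
  have hs1 : (1 - δ) / (2 + δ) ≤ 1 := by rw [div_le_one a3]; linarith
  have := pow_le_pow_left₀ (mul_nonneg hk (isoDist_nonneg j hs0 hs1)) (h _ hs0 hs1) 2
  rw [mul_pow, mul_pow] at this
  nlinarith [mul_le_mul_of_nonneg_left this (sq_nonneg (6 * (1 - δ) * (2 + δ) * δ))]

/-! ### Comparison principle and inequalities on the region -/

theorem mul_D_le {i j : ℕ} (hi : i ∈ ({1, 2, 6, 7, 8, 9, 10} : Set ℕ))
    (hj : j ∈ ({1, 2, 6, 7, 8, 9, 10} : Set ℕ)) {k m : ℝ} (hm : 0 ≤ m)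
    (h : ∀ δ t, Region δ t → k ^ 2 * normSq j (1 - δ ^ 2) t ≤ m ^ 2 * normSq i (1 - δ ^ 2) t)
    (T : Affine.Triangle ℝ Plane) : k * D T 3 j ≤ m * D T 3 i := by
  obtain ⟨δ, t, l, hr, hl, hT⟩ := exists_normSq T
  refine le_of_sq_le_sq ?_ (mul_nonneg hm dist_nonneg)
  rw [mul_pow, mul_pow, hT i hi, hT j hj]
  nlinarith [mul_le_mul_of_nonneg_left (h δ t hr) hl.le]

theorem D_le {i j : ℕ} (hi : i ∈ ({1, 2, 6, 7, 8, 9, 10} : Set ℕ))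
    (hj : j ∈ ({1, 2, 6, 7, 8, 9, 10} : Set ℕ))
    (h : ∀ δ t, Region δ t → normSq j (1 - δ ^ 2) t ≤ normSq i (1 - δ ^ 2) t)
    (T : Affine.Triangle ℝ Plane) : D T 3 j ≤ D T 3 i := by
  simpa using mul_D_le hi hj zero_le_one (k := 1) (by simpa using h) T

theorem Region.q_pos {δ t : ℝ} (h : Region δ t) : 0 < 1 - δ ^ 2 := by
  nlinarith [h.nonneg, h.lt_one]

/-- This is `(xy + yz + zx)^2 ≥ 3xyz(x + y + z)`, read off from the upper end of the region. -/
theorem Region.le_sq {δ t : ℝ} (h : Region δ t) : t ≤ (1 - δ ^ 2) ^ 2 := by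
  nlinarith [h.upper, mul_nonneg (sq_nonneg (1 - δ)) (sq_nonneg δ)]

theorem Region.upper_le_sq {δ t : ℝ} (_ : Region δ t) :
    (1 - δ) ^ 2 * (1 + 2 * δ) ≤ (1 - δ ^ 2) ^ 2 := by
  nlinarith [mul_nonneg (sq_nonneg (1 - δ)) (sq_nonneg δ)]

theorem Region.le_q {δ t : ℝ} (h : Region δ t) : t ≤ 1 - δ ^ 2 := by
  nlinarith [h.le_sq, h.q_pos, sq_nonneg δ]

/-- Schur's inequality of degree one for `x, y, z`. The lower end exceeds the left side by `δ^2 (1 -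
2δ)`, and for `δ ≥ 1/2` the left side is not positive. -/
theorem Region.schur {δ t : ℝ} (h : Region δ t) : 4 * (1 - δ ^ 2) - 3 ≤ t := by
  rcases le_total δ (1 / 2) with hd | hd
  · nlinarith [h.lower, mul_nonneg (sq_nonneg δ) (sub_nonneg.2 hd)]
  · nlinarith [h.pos]

/-- Schur's inequality for `yz, zx, xy`. -/
theorem Region.dual_schur {δ t : ℝ} (h : Region δ t) :
    0 ≤ 3 * (1 - δ ^ 2) ^ 3 - 4 * (1 - δ ^ 2) * t + t ^ 2 := by
  have e : 3 * (1 - δ ^ 2) ^ 3 - 4 * (1 - δ ^ 2) * t + t ^ 2 =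
      ((1 - δ) ^ 2 * δ) ^ 2 + ((1 - δ) ^ 2 * (1 + 2 * δ) - t) *
        (4 * (1 - δ ^ 2) - t - (1 - δ) ^ 2 * (1 + 2 * δ)) := by ring
  rw [e]
  have := h.upper
  have h1 := h.le_q
  have h2 := h.upper_le_sq
  have h3 := h.q_pos
  have h4 : 0 ≤ (1 - δ) ^ 2 * (1 + 2 * δ) - t := by linarith
  have h5 : 0 ≤ 4 * (1 - δ ^ 2) - t - (1 - δ) ^ 2 * (1 + 2 * δ) := by
    nlinarith [sq_nonneg δ]
  positivity

/-! ### Comparisons with constant 1 -/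

theorem D_ten_le_two (T : Affine.Triangle ℝ Plane) : D T 3 10 ≤ D T 3 2 := by
  refine D_le (by simp) (by simp) (fun δ t h => ?_) T
  have := h.pos
  have := h.le_q
  have := sq_nonneg δ
  simp only [normSq]
  nlinarith

/-- The difference of the squares is `8t(12 - 13q + t)`, nonnegative by Schur since `q ≤ 1`. -/
theorem D_two_le_one (T : Affine.Triangle ℝ Plane) : D T 3 2 ≤ D T 3 1 := by
  refine D_le (by simp) (by simp) (fun δ t h => ?_) T
  have h1 := h.pos
  have h2 := h.schur
  simp only [normSq]
  nlinarith [mul_nonneg h1.le (sub_nonneg.2 h2), mul_nonneg h1.le (sq_nonneg δ)]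

theorem D_one_le_six (T : Affine.Triangle ℝ Plane) : D T 3 1 ≤ D T 3 6 := by
  refine D_le (by simp) (by simp) (fun δ t h => ?_) T
  have h1 := h.pos
  have h2 := h.schur
  have h3 := h.q_pos
  have h4 := h.le_q
  have h5 := sq_nonneg δ
  simp only [normSq]
  set Q := 1 - δ ^ 2
  have hQ : 0 < 3 - Q := by linarith
  have hS : 0 < 9 * Q - t := by linarith
  have hf : 0 ≤ 2 * (3 - Q) ^ 2 - 9 * Q + t := by nlinarith
  have e : (9 * Q - t) ^ 2 * (1 - 4 * t / (3 - Q) ^ 2) - 9 * (9 * Q - t) * (Q - t) =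
      4 * t * (9 * Q - t) / (3 - Q) ^ 2 * (2 * (3 - Q) ^ 2 - 9 * Q + t) := by field_simp; ring
  rw [← sub_nonneg, e]
  positivity

theorem D_one_le_seven (T : Affine.Triangle ℝ Plane) : D T 3 1 ≤ D T 3 7 := by
  refine D_le (by simp) (by simp) (fun δ t h => ?_) T
  have h1 := h.pos
  have h2 := h.le_sq
  have h3 := h.q_pos
  have h5 := sq_nonneg δ
  simp only [normSq]
  set Q := 1 - δ ^ 2
  have hQ : 0 ≤ 1 - Q := by linarith
  have hf : 0 ≤ Q ^ 2 * (9 * Q - t) - 2 * t * (3 * Q + t) := by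
    have e : Q ^ 2 * (9 * Q - t) - 2 * t * (3 * Q + t) = (Q ^ 2 - t) * (Q ^ 2 + 6 * Q +
      2 * (t + Q ^ 2)) + 3 * Q ^ 3 * (1 - Q) := by ring
    have : 0 ≤ Q ^ 2 - t := by linarith
    rw [e]
    positivity
  have e : (9 * Q - t) ^ 2 - 16 * t ^ 2 * (3 * Q + t) / Q ^ 2 - 9 * (9 * Q - t) * (Q - t) =
      8 * t / Q ^ 2 * (Q ^ 2 * (9 * Q - t) - 2 * t * (3 * Q + t)) := by field_simp; ring
  rw [← sub_nonneg, e]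
  positivity

/-- In the common normalization `R` is `9q - t` and `2r` is `8t`, so this compares `(R - 2r)^2` with
Euler's `R(R - 2r)`. -/
theorem D_eight_le_one (T : Affine.Triangle ℝ Plane) : D T 3 8 ≤ D T 3 1 := by
  refine D_le (by simp) (by simp) (fun δ t h => ?_) T
  have h1 := h.pos
  have h2 := h.le_q
  simp only [normSq]
  nlinarith [mul_nonneg h1.le (sub_nonneg.2 h2)]

theorem D_nine_le_ten (T : Affine.Triangle ℝ Plane) : D T 3 9 ≤ D T 3 10 := by
  refine D_le (by simp) (by simp) (fun δ t h => ?_) T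
  have h1 := h.pos
  have h2 := h.le_sq
  have h3 := h.q_pos
  have h4 := h.dual_schur
  simp only [normSq]
  set Q := 1 - δ ^ 2
  have hf : 0 ≤ 9 * Q ^ 3 - 12 * Q * t + t ^ 2 + 2 * t * Q ^ 2 := by
    nlinarith [mul_nonneg h1.le (sub_nonneg.2 h2)]
  have e : (9 * Q - t) ^ 2 - 36 * t * (3 - Q) + 8 * t ^ 2 -
      ((9 * Q - t) ^ 2 - 4 * t * (9 * Q - t) * (3 * Q - t) / Q ^ 2) =
      4 * t / Q ^ 2 * (9 * Q ^ 3 - 12 * Q * t + t ^ 2 + 2 * t * Q ^ 2) := by field_simp; ring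
  rw [← sub_nonneg, e]
  positivity

/-! ### Comparisons reduced to the upper isosceles end -/

/-- For fixed `q` the difference of the squares decreases in `t`, so the isosceles value at the
largest `t`, called `u`, is the worst case. In the proof `hH` says that the difference quotient
between `t` and `u` has the right sign. The next two comparisons work in the same way. -/
theorem D_six_le_two (T : Affine.Triangle ℝ Plane) : D T 3 6 ≤ 3 * D T 3 2 := by
  suffices h : 1 * D T 3 6 ≤ 3 * D T 3 2 by simpa using h
  refine mul_D_le (by simp) (by simp) (by norm_num) (fun δ t h => ?_) T
  have hiso : (1 : ℝ) ^ 2 * normSq 6 (1 - δ ^ 2) ((1 - δ) ^ 2 * (1 + 2 * δ)) ≤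
      3 ^ 2 * normSq 2 (1 - δ ^ 2) ((1 - δ) ^ 2 * (1 + 2 * δ)) := by
    refine normSq_isosceles_le (by simp) (by simp) (by norm_num) (fun s h0 h1 => ?_)
      (by linarith [h.nonneg]) h.lt_one
    simp only [isoDist]
    rw [one_mul, mul_div_cancel₀ _ three_ne_zero]
    exact div_le_self (by positivity) (by nlinarith)
  have h1 := h.pos
  have h2 := h.le_q
  have h3 := h.q_pos
  have h4 := h.upper
  have h5 := h.upper_le_sq
  have h6 : 1 - δ ^ 2 ≤ 1 := by nlinarith [sq_nonneg δ]
  generalize (1 - δ) ^ 2 * (1 + 2 * δ) = u at *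
  generalize 1 - δ ^ 2 = Q at *
  have h7 : u ≤ Q := by nlinarith
  have hw : 4 / (3 - Q) ^ 2 ≤ 1 := by rw [div_le_one (by nlinarith)]; nlinarith
  have hw0 : 0 ≤ 4 / (3 - Q) ^ 2 := by positivity
  simp only [normSq] at hiso ⊢
  rw [mul_div_right_comm] at hiso ⊢
  generalize 4 / (3 - Q) ^ 2 = W at *
  have hH : 0 ≤ 8 * (18 * Q - t - u) + 288 * (3 - Q) -
      W * (81 * Q ^ 2 - 18 * Q * (t + u) + t ^ 2 + t * u + u ^ 2) := by
    have : 81 * Q ^ 2 - 18 * Q * (t + u) + t ^ 2 + t * u + u ^ 2 ≤ 81 := by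
      nlinarith [mul_nonneg h1.le (sub_nonneg.2 h2), mul_nonneg (h1.le.trans h4) (sub_nonneg.2 h7),
        mul_nonneg (h1.le.trans h4) h1.le]
    nlinarith [mul_le_mul_of_nonneg_left this hw0]
  nlinarith [mul_nonneg (sub_nonneg.2 h4) hH]

theorem D_seven_le_two (T : Affine.Triangle ℝ Plane) : D T 3 7 ≤ 3 * D T 3 2 := by
  suffices h : 1 * D T 3 7 ≤ 3 * D T 3 2 by simpa using h
  refine mul_D_le (by simp) (by simp) (by norm_num) (fun δ t h => ?_) T
  have hiso : (1 : ℝ) ^ 2 * normSq 7 (1 - δ ^ 2) ((1 - δ) ^ 2 * (1 + 2 * δ)) ≤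
      3 ^ 2 * normSq 2 (1 - δ ^ 2) ((1 - δ) ^ 2 * (1 + 2 * δ)) := by
    refine normSq_isosceles_le (by simp) (by simp) (by norm_num) (fun s h0 h1 => ?_)
      (by linarith [h.nonneg]) h.lt_one
    simp only [isoDist]
    rw [one_mul, mul_div_cancel₀ _ three_ne_zero, div_le_iff₀ (by linarith)]
    nlinarith
  have h1 := h.pos
  have h2 := h.le_sq
  have h3 := h.q_pos
  have h4 := h.upper
  have h5 := h.upper_le_sq
  have h6 : 1 - δ ^ 2 ≤ 1 := by nlinarith [sq_nonneg δ]
  generalize (1 - δ) ^ 2 * (1 + 2 * δ) = u at *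
  generalize 1 - δ ^ 2 = Q at *
  have hH : 0 ≤ 8 * (18 * Q - t - u) + 288 * (3 - Q) -
      16 / Q ^ 2 * (3 * Q * (t + u) + t ^ 2 + t * u + u ^ 2) := by
    have : 16 / Q ^ 2 * (3 * Q * (t + u) + t ^ 2 + t * u + u ^ 2) ≤ 144 := by
      rw [div_mul_eq_mul_div, div_le_iff₀ (by positivity)]
      have a1 : Q * t ≤ Q ^ 2 := by nlinarith
      have a2 : Q * u ≤ Q ^ 2 := by nlinarith
      have a3 : t ^ 2 ≤ Q ^ 2 := by nlinarith
      have a4 : u ^ 2 ≤ Q ^ 2 := by nlinarith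
      nlinarith [sq_nonneg (t - u)]
    nlinarith
  simp only [normSq] at hiso ⊢
  have e : 16 * t ^ 2 * (3 * Q + t) / Q ^ 2 = 16 / Q ^ 2 * (t ^ 2 * (3 * Q + t)) := by ring
  have e' : 16 * u ^ 2 * (3 * Q + u) / Q ^ 2 = 16 / Q ^ 2 * (u ^ 2 * (3 * Q + u)) := by ring
  rw [e'] at hiso
  rw [e]
  generalize 16 / Q ^ 2 = V at *
  nlinarith [mul_nonneg (sub_nonneg.2 h4) hH]

theorem D_ten_le_nine (T : Affine.Triangle ℝ Plane) : D T 3 10 ≤ 2 * D T 3 9 := by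
  suffices h : 1 * D T 3 10 ≤ 2 * D T 3 9 by simpa using h
  refine mul_D_le (by simp) (by simp) (by norm_num) (fun δ t h => ?_) T
  have hiso : (1 : ℝ) ^ 2 * normSq 10 (1 - δ ^ 2) ((1 - δ) ^ 2 * (1 + 2 * δ)) ≤
      2 ^ 2 * normSq 9 (1 - δ ^ 2) ((1 - δ) ^ 2 * (1 + 2 * δ)) := by
    refine normSq_isosceles_le (by simp) (by simp) (by norm_num) (fun s h0 h1 => ?_)
      (by linarith [h.nonneg]) h.lt_one
    simp only [isoDist]
    rw [← mul_div_assoc, one_mul, le_div_iff₀ (by linarith)]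
    nlinarith
  have h1 := h.pos
  have h2 := h.le_sq
  have h3 := h.q_pos
  have h4 := h.upper
  have h5 := h.upper_le_sq
  have h6 : 1 - δ ^ 2 ≤ 1 := by nlinarith [sq_nonneg δ]
  generalize (1 - δ) ^ 2 * (1 + 2 * δ) = u at *
  generalize 1 - δ ^ 2 = Q at *
  -- Scaling by `Q` cancels the `Q ^ 2` in the denominator; the bound `t ≤ Q ^ 2` becomes `a ≤ Q`.
  obtain ⟨a, rfl⟩ : ∃ a, t = Q * a := ⟨t / Q, by field_simp⟩
  obtain ⟨b, rfl⟩ : ∃ b, u = Q * b := ⟨u / Q, by field_simp⟩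
  have ha : a ≤ Q := by nlinarith
  have hb : b ≤ Q := by nlinarith
  have ha0 : 0 < a := by nlinarith
  have hab : a ≤ b := by nlinarith
  simp only [normSq] at hiso ⊢
  have e : ∀ a, 4 * (Q * a) * (9 * Q - Q * a) * (3 * Q - Q * a) / Q ^ 2 =
      4 * Q * a * (9 - a) * (3 - a) := fun a => by field_simp
  rw [e] at hiso ⊢
  have hH : 0 ≤ 3 * Q * (18 - a - b) + 16 * (27 - 12 * (a + b) + a ^ 2 + a * b + b ^ 2) -
      36 * (3 - Q) + 8 * Q * (a + b) := by
    nlinarith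
  nlinarith [mul_nonneg (mul_nonneg h3.le (sub_nonneg.2 hab)) hH]

/-! ### The sharper constants -/

/-- A cubic that lies above its chord on an interval is nonnegative there if it is so at the
endpoints. -/
theorem cubic_nonneg_of_endpoints {c₀ c₁ c₂ c₃ a b t : ℝ} (hat : a ≤ t) (htb : t ≤ b)
    (ha : 0 ≤ c₀ + c₁ * a + c₂ * a ^ 2 + c₃ * a ^ 3) (hb : 0 ≤ c₀ + c₁ * b + c₂ * b ^ 2 + c₃ * b ^ 3)
    (h : c₂ + c₃ * (a + b + t) ≤ 0) : 0 ≤ c₀ + c₁ * t + c₂ * t ^ 2 + c₃ * t ^ 3 := by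
  rcases hat.eq_or_lt with rfl | hat'
  · exact ha
  · have hab : 0 < b - a := by linarith
    refine nonneg_of_mul_nonneg_right (a := b - a) ?_ hab
    -- `c₂ + c₃ (a + b + t)` is the second divided difference at `a, b, t`; its sign puts the value
    -- at `t` above the chord.
    nlinarith [mul_nonneg (sub_nonneg.2 htb) ha, mul_nonneg (sub_nonneg.2 hat) hb,
      mul_nonneg (mul_nonneg hab.le (mul_nonneg (sub_nonneg.2 hat) (sub_nonneg.2 htb)))
        (neg_nonneg.2 h)]

/-- The lower end is the isosceles value at `-δ`. It is nonnegative only for `δ ≤ 1/2`; beyond that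
the effective left end of the `t`-range is 0. -/
theorem Region.lower_endpoint_le {i j : ℕ} (hi : i ∈ ({1, 2, 6, 7, 8, 9, 10} : Set ℕ))
    (hj : j ∈ ({1, 2, 6, 7, 8, 9, 10} : Set ℕ)) {k m : ℝ} (hk : 0 ≤ k)
    (h : ∀ s, 0 ≤ s → s ≤ 1 → k * isoDist j s ≤ m * isoDist i s) {δ t : ℝ} (hr : Region δ t)
    (hδ : δ ≤ 1 / 2) : k ^ 2 * normSq j (1 - δ ^ 2) ((1 + δ) ^ 2 * (1 - 2 * δ)) ≤
      m ^ 2 * normSq i (1 - δ ^ 2) ((1 + δ) ^ 2 * (1 - 2 * δ)) := by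
  have := normSq_isosceles_le hi hj hk h (δ := -δ) (by linarith) (by linarith [hr.nonneg])
  simpa only [neg_sq, sub_neg_eq_add, mul_neg, ← sub_eq_add_neg] using this

theorem Region.upper_endpoint_le {i j : ℕ} (hi : i ∈ ({1, 2, 6, 7, 8, 9, 10} : Set ℕ))
    (hj : j ∈ ({1, 2, 6, 7, 8, 9, 10} : Set ℕ)) {k m : ℝ} (hk : 0 ≤ k)
    (h : ∀ s, 0 ≤ s → s ≤ 1 → k * isoDist j s ≤ m * isoDist i s) {δ t : ℝ} (hr : Region δ t) :
    k ^ 2 * normSq j (1 - δ ^ 2) ((1 - δ) ^ 2 * (1 + 2 * δ)) ≤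
      m ^ 2 * normSq i (1 - δ ^ 2) ((1 - δ) ^ 2 * (1 + 2 * δ)) :=
  normSq_isosceles_le hi hj hk h (by linarith [hr.nonneg]) hr.lt_one

/-- `2s^2 - 2ks + 1 - k` has a double root precisely when `k^2 + 2k = 2`. For `k = √3 - 1` the root
is `s = k / 2`. -/
theorem mul_isoDist_six_le_one (s : ℝ) : (√3 - 1) * isoDist 6 s ≤ 1 * isoDist 1 s := by
  have h3 : √3 ^ 2 = 3 := Real.sq_sqrt (by norm_num)
  simp only [isoDist]
  rw [mul_div_assoc', div_le_iff₀ (by positivity)]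
  nlinarith [sq_nonneg (2 * s - (√3 - 1))]

/-- The constant makes the quadratic in `s` a multiple of a square, with double root `2 - √2`. -/
theorem mul_isoDist_seven_le_one {s : ℝ} (h1 : s ≤ 1) :
    (7 + 4 * √2) / 17 * isoDist 7 s ≤ 1 * isoDist 1 s := by
  have h2 : √2 ^ 2 = 2 := Real.sq_sqrt (by norm_num)
  have h0 : 0 ≤ √2 := Real.sqrt_nonneg 2
  simp only [isoDist]
  rw [mul_div_assoc', div_le_iff₀ (by linarith)]
  have e : 1 * 1 * (2 - s) - (7 + 4 * √2) / 17 * (2 + s - 2 * s ^ 2) =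
      2 * ((7 + 4 * √2) / 17) * (s - (2 - √2)) ^ 2 +
        (√2 ^ 2 - 2) * (18 / 17 - 8 / 17 * √2 - 16 / 17 * s) := by ring
  rw [← sub_nonneg, e, h2, sub_self, zero_mul, add_zero]
  positivity

/-- After removing the positive factor `9q - t`, the difference is a concave quadratic in `t`, so it
suffices to check the two ends of the `t`-range. -/
theorem mul_D_six_le_one (T : Affine.Triangle ℝ Plane) : (√3 - 1) * D T 3 6 ≤ D T 3 1 := by
  have hk0 : 0 ≤ √3 - 1 := by
    rw [sub_nonneg, Real.one_le_sqrt]; norm_num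
  have hk1 : (√3 - 1) ^ 2 ≤ 1 := by
    nlinarith [Real.sq_sqrt (show (0 : ℝ) ≤ 3 by norm_num)]
  have hkk := sq_nonneg (√3 - 1)
  rw [← one_mul (D T 3 1)]
  refine mul_D_le (by simp) (by simp) zero_le_one (fun δ t h => ?_) T
  have hb := h.upper_endpoint_le (i := 1) (j := 6) (by simp) (by simp) hk0
    fun s _ _ => mul_isoDist_six_le_one s
  have ha : δ ≤ 1 / 2 → _ := h.lower_endpoint_le (i := 1) (j := 6) (by simp) (by simp) hk0
    fun s _ _ => mul_isoDist_six_le_one s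
  have hl := h.lower
  have hd := h.nonneg
  have h1 := h.pos
  have h2 := h.le_q
  have h3 := h.q_pos
  have h4 := h.upper
  have h5 : (1 - δ) ^ 2 * (1 + 2 * δ) ≤ 1 - δ ^ 2 := by nlinarith [h.upper_le_sq, sq_nonneg δ]
  have h6 : (1 + δ) ^ 2 * (1 - 2 * δ) ≤ 1 - δ ^ 2 := by linarith
  have h7 : δ ≤ 1 / 2 → 0 ≤ (1 + δ) ^ 2 * (1 - 2 * δ) := fun h =>
    mul_nonneg (sq_nonneg _) (by linarith)
  have h8 : 1 - δ ^ 2 ≤ 1 := by nlinarith [sq_nonneg δ]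
  generalize (1 - δ) ^ 2 * (1 + 2 * δ) = u at *
  generalize (1 + δ) ^ 2 * (1 - 2 * δ) = v at *
  generalize 1 - δ ^ 2 = Q at *
  generalize (√3 - 1) ^ 2 = K at *
  simp only [normSq] at *
  have hW : 0 ≤ 4 * K / (3 - Q) ^ 2 := by
    positivity
  have e : ∀ t, 1 ^ 2 * (9 * (9 * Q - t) * (Q - t)) -
      K * ((9 * Q - t) ^ 2 * (1 - 4 * t / (3 - Q) ^ 2)) = (9 * Q - t) * (9 * Q * (1 - K) +
      (K - 9 + 9 * Q * (4 * K / (3 - Q) ^ 2)) * t + -(4 * K / (3 - Q) ^ 2) * t ^ 2 + 0 * t ^ 3) := by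
    intro t; ring
  have pos : ∀ t, t ≤ Q → 0 < 9 * Q - t := fun t ht => by linarith
  rw [← sub_nonneg, e] at hb ⊢
  refine mul_nonneg (pos t h2).le ?_
  have hb' := nonneg_of_mul_nonneg_right hb (pos u h5)
  rcases le_total δ (1 / 2) with hδ | hδ
  · have ha' := ha hδ
    rw [← sub_nonneg, e] at ha'
    exact cubic_nonneg_of_endpoints hl h4 (nonneg_of_mul_nonneg_right ha' (pos v h6)) hb'
      (by linarith)
  · refine cubic_nonneg_of_endpoints h1.le h4 ?_ hb' (by linarith)
    have : 0 ≤ 9 * Q * (1 - K) := mul_nonneg (by linarith) (by linarith)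
    simpa using this

theorem cubic_bound_one_seven {K a : ℝ} (hK1 : 554 / 1000 ≤ K) (hK2 : K ≤ 555 / 1000)
    (ha0 : 0 ≤ a) : 0 ≤ 9 * (9 - a) * (1 - a) - K * (9 - a) ^ 2 +
      16 * K * (a ^ 2 * (3 + a)) * (16 / 15) := by
  have c1 : 0 ≤ 9 * (9 - a) * (1 - a) - 554 / 1000 * (9 - a) ^ 2 +
      16 * (554 / 1000) * (a ^ 2 * (3 + a)) * (16 / 15) := by
    nlinarith [mul_nonneg ha0 (sq_nonneg (a - 17 / 20)), sq_nonneg (a - 17 / 20)]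
  have c2 : 0 ≤ 9 * (9 - a) * (1 - a) - 555 / 1000 * (9 - a) ^ 2 +
      16 * (555 / 1000) * (a ^ 2 * (3 + a)) * (16 / 15) := by
    nlinarith [mul_nonneg ha0 (sq_nonneg (a - 17 / 20)), sq_nonneg (a - 17 / 20)]
  linarith [mul_nonneg (sub_nonneg.2 hK1) c2, mul_nonneg (sub_nonneg.2 hK2) c1]

/-- This is the slope in `t` at the lower end, with the squared constant replaced by its lower bound
`0.554`. Homogenizing by `1 = 4(e + δ)` leaves a form in `e, δ` with positive coefficients. -/
theorem endpoint_slope_one_seven {δ : ℝ} (h0 : 0 ≤ δ) (h3 : 0 < 1 - δ ^ 2) (hδ : δ ≤ 1 / 4) :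
     0 ≤ 9 * (-10 * (1 - δ ^ 2) + 2 * ((1 + δ) ^ 2 * (1 - 2 * δ))) +
      554 / 1000 * (18 * (1 - δ ^ 2) - 2 * ((1 + δ) ^ 2 * (1 - 2 * δ))) +
      16 * (554 / 1000) / (1 - δ ^ 2) ^ 2 * (6 * (1 - δ ^ 2) * ((1 + δ) ^ 2 * (1 - 2 * δ)) +
        3 * ((1 + δ) ^ 2 * (1 - 2 * δ)) ^ 2) := by
  obtain ⟨e, he⟩ : ∃ e, e = 1 / 4 - δ := ⟨_, rfl⟩
  have he0 : 0 ≤ e := by linarith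
  refine nonneg_of_mul_nonneg_right (a := (1 - δ ^ 2) ^ 2) ?_ (by positivity)
  have : 0 ≤ (1 + δ) ^ 3 * (106496 / 25 * e ^ 4 + 346112 / 25 * δ * e ^ 3 + 1763152 / 125 * δ ^ 2 * e ^ 2 +
    116616 / 25 * δ ^ 3 * e + 2757 / 25 * δ ^ 4) := by positivity
  refine this.trans_eq ?_
  field_simp
  rw [he]
  ring

/-- For `δ ≤ 1/4` the difference is at least its value at the lower end, which is isosceles. For `δ
≥ 1/4` one has `q ≤ 15/16`, far enough from the extremal shape for a rough cubic estimate in `a = t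
/ q`. -/
theorem mul_D_seven_le_one (T : Affine.Triangle ℝ Plane) :
    (7 + 4 * √2) / 17 * D T 3 7 ≤ D T 3 1 := by
  have hs : √2 ^ 2 = 2 := Real.sq_sqrt (by norm_num)
  have hs0 : 0 ≤ √2 := Real.sqrt_nonneg 2
  have hk0 : 0 ≤ (7 + 4 * √2) / 17 := by positivity
  have hs1 : 1.414 ≤ √2 := Real.le_sqrt_of_sq_le (by norm_num)
  have hs2 : √2 ≤ 1.415 := (Real.sqrt_le_left (by norm_num)).2 (by norm_num)
  have hK1 : 554 / 1000 ≤ ((7 + 4 * √2) / 17) ^ 2 := by nlinarith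
  have hK2 : ((7 + 4 * √2) / 17) ^ 2 ≤ 555 / 1000 := by nlinarith
  rw [← one_mul (D T 3 1)]
  refine mul_D_le (by simp) (by simp) zero_le_one (fun δ t h => ?_) T
  have ha : δ ≤ 1 / 2 → _ := h.lower_endpoint_le (i := 1) (j := 7) (by simp) (by simp) hk0
    fun s _ h1 => mul_isoDist_seven_le_one h1
  have hl := h.lower
  have h0 := h.nonneg
  have h1 := h.pos
  have h2 := h.le_q
  have h3 := h.q_pos
  generalize ((7 + 4 * √2) / 17) ^ 2 = K at *
  rcases le_total δ (1 / 4) with hδ | hδ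
  · replace ha := ha (by linarith)
    have hv : 0 ≤ (1 + δ) ^ 2 * (1 - 2 * δ) := mul_nonneg (sq_nonneg _) (by linarith)
    have hpoly := endpoint_slope_one_seven h0 h3 hδ
    generalize (1 + δ) ^ 2 * (1 - 2 * δ) = v at *
    generalize 1 - δ ^ 2 = Q at *
    simp only [normSq] at *
    rw [← sub_nonneg] at ha ⊢
    have e : ∀ t, 1 ^ 2 * (9 * (9 * Q - t) * (Q - t)) -
        K * ((9 * Q - t) ^ 2 - 16 * t ^ 2 * (3 * Q + t) / Q ^ 2) = 9 * (9 * Q - t) * (Q - t) -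
        K * (9 * Q - t) ^ 2 + K * (16 / Q ^ 2) * (t ^ 2 * (3 * Q + t)) := fun t => by ring
    rw [e] at ha ⊢
    have e' : 16 * (554 / 1000) / Q ^ 2 = 554 / 1000 * (16 / Q ^ 2) := by ring
    rw [e'] at hpoly
    have hV : 0 ≤ 16 / Q ^ 2 := by positivity
    generalize 16 / Q ^ 2 = V at *
    have hH : 0 ≤ 9 * (-10 * Q + t + v) + K * (18 * Q - t - v) +
        K * V * (3 * Q * (t + v) + t ^ 2 + t * v + v ^ 2) := by
      -- The difference quotient is its value at `K = 0.554`, `t = v`, given by `hpoly`, plus the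
      -- two nonnegative increments `f1` and `f2`.
      have f1 : 0 ≤ (K - 554 / 1000) * (18 * Q - t - v +
          V * (3 * Q * (t + v) + t ^ 2 + t * v + v ^ 2)) := by
        have : 0 ≤ 18 * Q - t - v := by linarith
        have : 0 ≤ K - 554 / 1000 := by linarith
        positivity
      have f2 : 0 ≤ (t - v) * (9 - 554 / 1000 + 554 / 1000 * V * (3 * Q + t + 2 * v)) := by
        have : 0 ≤ t - v := by linarith
        have : 0 ≤ 554 / 1000 * V * (3 * Q + t + 2 * v) := by positivity
        nlinarith
      linarith
    linarith [mul_nonneg (sub_nonneg.2 hl) hH]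
  · have hQ : 1 - δ ^ 2 ≤ 15 / 16 := by nlinarith
    generalize 1 - δ ^ 2 = Q at *
    simp only [normSq]
    obtain ⟨a, rfl⟩ : ∃ a, t = Q * a := ⟨t / Q, by field_simp⟩
    have ha1 : a ≤ 1 := by nlinarith
    have ha0 : 0 < a := by nlinarith
    have e : 1 ^ 2 * (9 * (9 * Q - Q * a) * (Q - Q * a)) -
        K * ((9 * Q - Q * a) ^ 2 - 16 * (Q * a) ^ 2 * (3 * Q + Q * a) / Q ^ 2) =
        Q ^ 2 * (9 * (9 - a) * (1 - a) - K * (9 - a) ^ 2 + 16 * K * (a ^ 2 * (3 + a)) / Q) := by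
      field_simp
      ring
    rw [← sub_nonneg, e]
    refine mul_nonneg (sq_nonneg _) ?_
    have hK : 0 ≤ 16 * K * (a ^ 2 * (3 + a)) := by
      have : 0 ≤ K := by linarith
      positivity
    have hd : 16 * K * (a ^ 2 * (3 + a)) * (16 / 15) ≤ 16 * K * (a ^ 2 * (3 + a)) / Q := by
      rw [le_div_iff₀ h3]
      nlinarith
    refine le_trans ?_ (add_le_add_right hd _)
    exact cubic_bound_one_seven hK1 hK2 ha0.le

/-- Since `C ≥ 1` and `q ≤ 1`, the quadratic and cubic coefficients in `t` are both nonpositive, so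
the difference is concave for `t ≥ 0` and only the ends matter. -/
theorem D_six_le_mul_seven {C : ℝ} (hC : 1 ≤ C)
    (hiso : ∀ s, 0 ≤ s → s ≤ 1 → 1 * isoDist 6 s ≤ C * isoDist 7 s)
    (T : Affine.Triangle ℝ Plane) : D T 3 6 ≤ C * D T 3 7 := by
  rw [← one_mul (D T 3 6)]
  refine mul_D_le (by simp) (by simp) (by linarith) (fun δ t h => ?_) T
  have hb := h.upper_endpoint_le (i := 7) (j := 6) (by simp) (by simp) zero_le_one hiso
  have ha : δ ≤ 1 / 2 → _ := h.lower_endpoint_le (i := 7) (j := 6) (by simp) (by simp) zero_le_one hiso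
  have hK : 1 ≤ C ^ 2 := by nlinarith
  have hl := h.lower
  have h1 := h.pos
  have h3 := h.q_pos
  have h4 := h.upper
  have h7 : δ ≤ 1 / 2 → 0 ≤ (1 + δ) ^ 2 * (1 - 2 * δ) := fun h =>
    mul_nonneg (sq_nonneg _) (by linarith)
  have h8 : 1 - δ ^ 2 ≤ 1 := by nlinarith [sq_nonneg δ]
  generalize (1 - δ) ^ 2 * (1 + 2 * δ) = u at *
  generalize (1 + δ) ^ 2 * (1 - 2 * δ) = v at *
  generalize 1 - δ ^ 2 = Q at *
  generalize C ^ 2 = K at *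
  simp only [normSq] at *
  have hQ : 0 < 3 - Q := by linarith
  have e : ∀ t, K * ((9 * Q - t) ^ 2 - 16 * t ^ 2 * (3 * Q + t) / Q ^ 2) -
      1 ^ 2 * ((9 * Q - t) ^ 2 * (1 - 4 * t / (3 - Q) ^ 2)) = 81 * Q ^ 2 * (K - 1) +
      (-18 * Q * (K - 1) + 324 * Q ^ 2 / (3 - Q) ^ 2) * t +
      (K - 1 - 48 * K / Q - 72 * Q / (3 - Q) ^ 2) * t ^ 2 +
      (-16 * K / Q ^ 2 + 4 / (3 - Q) ^ 2) * t ^ 3 := by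
    intro t; field_simp; ring
  rw [← sub_nonneg, e] at hb ⊢
  have hc3 : -16 * K / Q ^ 2 + 4 / (3 - Q) ^ 2 ≤ 0 := by
    have f1 : 4 / (3 - Q) ^ 2 ≤ 1 := by rw [div_le_one (by positivity)]; nlinarith
    have f2 : 1 ≤ 16 * K / Q ^ 2 := by rw [le_div_iff₀ (by positivity)]; nlinarith
    rw [neg_mul, neg_div]
    linarith
  have hc2 : K - 1 - 48 * K / Q - 72 * Q / (3 - Q) ^ 2 ≤ 0 := by
    have f1 : 0 ≤ 72 * Q / (3 - Q) ^ 2 := by positivity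
    have f2 : K ≤ 48 * K / Q := by rw [le_div_iff₀ (by positivity)]; nlinarith
    linarith
  rcases le_total δ (1 / 2) with hδ | hδ
  · have ha' := ha hδ
    rw [← sub_nonneg, e] at ha'
    have := h7 hδ
    refine cubic_nonneg_of_endpoints hl h4 ha' hb ?_
    linarith [mul_nonneg (neg_nonneg.2 hc3) (by linarith : 0 ≤ v + u + t)]
  · refine cubic_nonneg_of_endpoints h1.le h4 ?_ hb ?_
    · have : 0 ≤ 81 * Q ^ 2 * (K - 1) := mul_nonneg (by positivity) (by linarith)
      simpa using this
    · linarith [mul_nonneg (neg_nonneg.2 hc3) (by linarith : 0 ≤ 0 + u + t)]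

theorem endpoint_slope_six_seven {δ : ℝ} (h0 : 0 ≤ δ) (h3 : 0 < 1 - δ ^ 2) (hδ : δ ≤ 2 / 5) :
     0 ≤ -(19 / 100 * (18 * (1 - δ ^ 2) - 2 * ((1 + δ) ^ 2 * (1 - 2 * δ)))) +
      81 / 100 * (16 / (1 - δ ^ 2) ^ 2) * (6 * (1 - δ ^ 2) * ((1 + δ) ^ 2 * (1 - 2 * δ)) +
        3 * ((1 + δ) ^ 2 * (1 - 2 * δ)) ^ 2) - 4 / (3 - (1 - δ ^ 2)) ^ 2 *
      (81 * (1 - δ ^ 2) ^ 2 - 36 * (1 - δ ^ 2) * ((1 + δ) ^ 2 * (1 - 2 * δ)) +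
        3 * ((1 + δ) ^ 2 * (1 - 2 * δ)) ^ 2) := by
  obtain ⟨e, he⟩ : ∃ e, e = 2 / 5 - δ := ⟨_, rfl⟩
  have he0 : 0 ≤ e := by linarith
  have h23 : 3 - (1 - δ ^ 2) = 2 + δ ^ 2 := by ring
  rw [h23]
  refine nonneg_of_mul_nonneg_right (a := (1 - δ ^ 2) ^ 2 * (2 + δ ^ 2) ^ 2) ?_ (by positivity)
  have : 0 ≤ (1 + δ) ^ 3 * (3203125 / 8 * e ^ 8 + 10890625 / 4 * δ * e ^ 7 +
    127175625 / 16 * δ ^ 2 * e ^ 6 + 103005875 / 8 * δ ^ 3 * e ^ 5 +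
    199437575 / 16 * δ ^ 4 * e ^ 4 + 14390835 / 2 * δ ^ 5 * e ^ 3 +
    36718275 / 16 * δ ^ 6 * e ^ 2 + 12796983 / 40 * δ ^ 7 * e +
    2049651 / 400 * δ ^ 8) := by positivity
  refine this.trans_eq ?_
  field_simp
  rw [he]
  ring

/-- Same split as for `X₁` against `X₇`: comparison with the lower end for `δ ≤ 2/5`, and a direct
estimate with `q ≤ 21/25` beyond. The interval for `C` only serves to place `C ^ 2` in `[0.81,
0.811]`. -/
theorem mul_D_seven_le_six {C : ℝ} (hC0 : 0.9001 ≤ C) (hC1 : C ≤ 0.9003)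
    (hiso : ∀ s, 0 ≤ s → s ≤ 1 → C * isoDist 7 s ≤ 1 * isoDist 6 s)
    (T : Affine.Triangle ℝ Plane) : C * D T 3 7 ≤ D T 3 6 := by
  rw [← one_mul (D T 3 6)]
  refine mul_D_le (by simp) (by simp) zero_le_one (fun δ t h => ?_) T
  have ha : δ ≤ 1 / 2 → _ :=
    h.lower_endpoint_le (i := 6) (j := 7) (by simp) (by simp) (by linarith) hiso
  have hK1 : 81 / 100 ≤ C ^ 2 := by nlinarith
  have hK2 : C ^ 2 ≤ 811 / 1000 := by nlinarith
  have hl := h.lower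
  have h0 := h.nonneg
  have h1 := h.pos
  have h2 := h.le_q
  have h3 := h.q_pos
  have h8 : 1 - δ ^ 2 ≤ 1 := by nlinarith [sq_nonneg δ]
  generalize C ^ 2 = K at *
  rcases le_total δ (2 / 5) with hδ | hδ
  · replace ha := ha (by linarith)
    have hv : 0 ≤ (1 + δ) ^ 2 * (1 - 2 * δ) := mul_nonneg (sq_nonneg _) (by linarith)
    have hpoly := endpoint_slope_six_seven h0 h3 hδ
    generalize (1 + δ) ^ 2 * (1 - 2 * δ) = v at *
    generalize 1 - δ ^ 2 = Q at *
    simp only [normSq] at *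
    rw [← sub_nonneg] at ha ⊢
    have e : ∀ t, 1 ^ 2 * ((9 * Q - t) ^ 2 * (1 - 4 * t / (3 - Q) ^ 2)) -
        K * ((9 * Q - t) ^ 2 - 16 * t ^ 2 * (3 * Q + t) / Q ^ 2) = (1 - K) * (9 * Q - t) ^ 2 +
        K * (16 / Q ^ 2) * (t ^ 2 * (3 * Q + t)) - 4 / (3 - Q) ^ 2 * (t * (9 * Q - t) ^ 2) :=
      fun t => by ring
    rw [e] at ha ⊢
    have hV : 0 ≤ 16 / Q ^ 2 := by positivity
    have hW : 0 ≤ 4 / (3 - Q) ^ 2 := by positivity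
    generalize 16 / Q ^ 2 = V at *
    generalize 4 / (3 - Q) ^ 2 = W at *
    have hH : 0 ≤ -((1 - K) * (18 * Q - t - v)) +
        K * V * (3 * Q * (t + v) + t ^ 2 + t * v + v ^ 2) -
        W * (81 * Q ^ 2 - 18 * Q * (t + v) + t ^ 2 + t * v + v ^ 2) := by
      have f1 : 0 ≤ (K - 81 / 100) * (18 * Q - t - v +
          V * (3 * Q * (t + v) + t ^ 2 + t * v + v ^ 2)) := by
        have : 0 ≤ 18 * Q - t - v := by linarith
        have : 0 ≤ K - 81 / 100 := by linarith
        positivity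
      have f2 : 0 ≤ (t - v) * (19 / 100 + 81 / 100 * V * (3 * Q + t + 2 * v) +
          W * (18 * Q - t - 2 * v)) := by
        have : 0 ≤ t - v := by linarith
        have : 0 ≤ 18 * Q - t - 2 * v := by linarith
        positivity
      linarith
    linarith [mul_nonneg (sub_nonneg.2 hl) hH]
  · have hQ : 1 - δ ^ 2 ≤ 21 / 25 := by nlinarith
    generalize 1 - δ ^ 2 = Q at *
    simp only [normSq]
    obtain ⟨a, rfl⟩ : ∃ a, t = Q * a := ⟨t / Q, by field_simp⟩
    have ha1 : a ≤ 1 := by nlinarith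
    have ha0 : 0 < a := by nlinarith
    have hQ3 : 0 < 3 - Q := by linarith
    have e : 1 ^ 2 * ((9 * Q - Q * a) ^ 2 * (1 - 4 * (Q * a) / (3 - Q) ^ 2)) -
        K * ((9 * Q - Q * a) ^ 2 - 16 * (Q * a) ^ 2 * (3 * Q + Q * a) / Q ^ 2) =
        Q ^ 2 * ((1 - K) * (9 - a) ^ 2 + 16 * K * (a ^ 2 * (3 + a)) / Q -
          Q / (3 - Q) ^ 2 * (4 * (a * (9 - a) ^ 2))) := by
      field_simp
      ring
    rw [← sub_nonneg, e]
    refine mul_nonneg (sq_nonneg _) ?_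
    have hK : 0 ≤ 16 * K * (a ^ 2 * (3 + a)) := by
      have : 0 ≤ K := by linarith
      positivity
    have d1 : 16 * K * (a ^ 2 * (3 + a)) * (25 / 21) ≤ 16 * K * (a ^ 2 * (3 + a)) / Q := by
      rw [le_div_iff₀ h3]
      nlinarith
    -- The left side increases with `Q`, and at `Q = 21/25` it is only slightly above `9/50`.
    have d2 : Q / (3 - Q) ^ 2 ≤ 9 / 50 + 1 / 2500 := by
      rw [div_le_iff₀ (by positivity)]
      nlinarith
    have d3 := mul_le_mul_of_nonneg_right d2 (show 0 ≤ 4 * (a * (9 - a) ^ 2) by positivity)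
    have c1 : 0 ≤ 19 / 100 * (9 - a) ^ 2 + 16 * (81 / 100) * (a ^ 2 * (3 + a)) * (25 / 21) -
        (9 / 50 + 1 / 2500) * (4 * (a * (9 - a) ^ 2)) := by
      nlinarith [mul_nonneg ha0.le (sq_nonneg (a - 9 / 20)), sq_nonneg (a - 9 / 20)]
    have c2 : 0 ≤ 189 / 1000 * (9 - a) ^ 2 + 16 * (811 / 1000) * (a ^ 2 * (3 + a)) * (25 / 21) -
        (9 / 50 + 1 / 2500) * (4 * (a * (9 - a) ^ 2)) := by
      nlinarith [mul_nonneg ha0.le (sq_nonneg (a - 9 / 20)), sq_nonneg (a - 9 / 20)]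
    linarith [mul_nonneg (sub_nonneg.2 hK1) c2, mul_nonneg (sub_nonneg.2 hK2) c1]

/-! ### Optimality from a single isosceles shape -/

theorem bestLower_of {i j : ℕ} (hi : i ∈ ({1, 2, 4, 5, 6, 7, 8, 9, 10} : Set ℕ))
    (hj : j ∈ ({1, 2, 4, 5, 6, 7, 8, 9, 10} : Set ℕ)) {L : ℝ}
    (h : ∀ T : Affine.Triangle ℝ Plane, L * D T 3 j ≤ D T 3 i) (s : ℝ)
    (hs : s ∈ Set.Icc (0 : ℝ) 1) (hpos : 0 < isoDist j s)
    (hle : isoDist i s ≤ L * isoDist j s) : BestLower 3 i j L := by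
  refine ⟨h, fun k hk => ?_⟩
  have := isoDist_le_of_forall hi hj (k := k) (m := 1) (by simpa using hk) hs
  exact le_of_mul_le_mul_right (by linarith) hpos

theorem bestUpper_of {i j : ℕ} (hi : i ∈ ({1, 2, 4, 5, 6, 7, 8, 9, 10} : Set ℕ))
    (hj : j ∈ ({1, 2, 4, 5, 6, 7, 8, 9, 10} : Set ℕ)) {U : ℝ}
    (h : ∀ T : Affine.Triangle ℝ Plane, D T 3 i ≤ U * D T 3 j) (s : ℝ)
    (hs : s ∈ Set.Icc (0 : ℝ) 1) (hpos : 0 < isoDist j s)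
    (hle : U * isoDist j s ≤ isoDist i s) : BestUpper 3 i j U := by
  refine ⟨h, fun k hk => ?_⟩
  have := isoDist_le_of_forall hj hi (k := 1) (m := k) (by simpa using hk) hs
  exact le_of_mul_le_mul_right (by linarith) hpos

theorem noUpper_of {i j : ℕ} (hi : i ∈ ({1, 2, 4, 5, 6, 7, 8, 9, 10} : Set ℕ))
    (hj : j ∈ ({1, 2, 4, 5, 6, 7, 8, 9, 10} : Set ℕ)) (s : ℝ)
    (hs : s ∈ Set.Icc (0 : ℝ) 1) (hpos : 0 < isoDist i s) (hz : isoDist j s = 0) :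
    NoUpper 3 i j := by
  intro k
  by_contra! h
  have := isoDist_le_of_forall hj hi (k := 1) (m := k) (by simpa using h) hs
  rw [hz] at this
  linarith

theorem bestLower_nine_ten : BestLower 3 9 10 (1 / 2) := by
  refine ⟨fun T => by linarith [D_ten_le_nine T], fun k hk => ?_⟩
  by_contra! hlt
  have hk0 : 0 < k := by linarith
  have hs1 : 1 / (2 * k) < 1 := by rw [div_lt_one (by positivity)]; linarith
  have hs0 : 0 < 1 / (2 * k) := by positivity
  -- The ratio is `1 / (2 - s)`, which tends to `1/2` only as `s → 0`, where both distances vanish.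
  -- For `k > 1/2` this `s` is positive and the ratio `k / (k + 1/2)` is still below `k`.
  have := isoDist_le_of_forall (i := 9) (j := 10) (by simp) (by simp) (k := k) (m := 1)
    (by simpa using hk) (s := 1 - 1 / (2 * k)) ⟨by linarith, by linarith⟩
  simp only [isoDist] at this
  have e : 2 - (1 - 1 / (2 * k)) = (k + 1 / 2) / k := by field_simp; ring
  rw [e, one_mul, div_div_eq_mul_div, le_div_iff₀ (by positivity)] at this
  nlinarith [mul_pos hk0 (sub_pos.2 hs1)]

/-! ### Extremal values of `D(3,6)/D(3,7)` and the quintic -/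

/-- `isoDist 6 = isoNum / isoDen * isoDist 7`. -/
def isoNum (s : ℝ) : ℝ := (1 + 2 * s) * (2 - s)

/-- `isoDist 6 = isoNum / isoDen * isoDist 7`. -/
def isoDen (s : ℝ) : ℝ := (1 + 2 * s ^ 2) * (2 + s - 2 * s ^ 2)

/-- The critical points of `isoNum / isoDen` are the roots of this polynomial. -/
def critPoly (s : ℝ) : ℝ := 1 - 4 * s - 5 * s ^ 2 + 5 * s ^ 3 + 10 * s ^ 4 - 4 * s ^ 5

/-- The quotient of the difference of the values of `isoNum / isoDen` at `s` and at a critical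
point `r` by `(s - r) ^ 2`. -/
def critQuot (s r : ℝ) : ℝ :=
  (8 + 16 * r - 12 * r ^ 2 - 40 * r ^ 3 + 16 * r ^ 4) + (4 - 10 * r - 28 * r ^ 2 + 16 * r ^ 3) * s +
    (-8 - 12 * r + 8 * r ^ 2) * s ^ 2

/-- The term linear in `s - r` is a multiple of `critPoly r`. At a critical point only the square
survives, so the sign of `critQuot` on `[0, 1]` decides whether `r` is a global maximum or minimum.
-/
theorem isoNum_mul_isoDen_sub {r : ℝ} (hr : critPoly r = 0) (s : ℝ) :
    isoNum r * isoDen s - isoNum s * isoDen r = (s - r) ^ 2 * critQuot s r := by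
  have : isoNum r * isoDen s - isoNum s * isoDen r =
      (s - r) ^ 2 * critQuot s r - 4 * (s - r) * critPoly r := by
    simp only [isoNum, isoDen, critQuot, critPoly]; ring
  rw [this, hr, mul_zero, sub_zero]

theorem one_le_isoDen {s : ℝ} (h0 : 0 ≤ s) (h1 : s ≤ 1) : 1 ≤ isoDen s :=
  one_le_mul_of_one_le_of_one_le (by nlinarith) (by nlinarith)

theorem isoDen_pos {s : ℝ} (h0 : 0 ≤ s) (h1 : s ≤ 1) : 0 < isoDen s :=
  one_pos.trans_le (one_le_isoDen h0 h1)

/-- Elimination of `r`: once denominators are cleared, the quintic at the ratio is divisible by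
`critPoly r`, and the long polynomial is the cofactor. -/
theorem quintic_critical_value {r : ℝ} (hr : critPoly r = 0) (h0 : isoDen r ≠ 0) :
    quintic (isoNum r / isoDen r) = 0 := by
  have : isoDen r ^ 5 * quintic (isoNum r / isoDen r) = critPoly r *
      (-2304 - 20736 * r + 111488 * r ^ 2 + 300768 * r ^ 3 - 421744 * r ^ 4 - 816248 * r ^ 5 +
      798464 * r ^ 6 + 829384 * r ^ 7 - 1387112 * r ^ 8 + 50272 * r ^ 9 + 1484608 * r ^ 10 -
      763072 * r ^ 11 - 585344 * r ^ 12 + 441344 * r ^ 13 - 25600 * r ^ 15) := by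
    have e : isoDen r ^ 5 * quintic (isoNum r / isoDen r) = 6137 * isoNum r ^ 5 -
        14689 * isoNum r ^ 4 * isoDen r + 14429 * isoNum r ^ 3 * isoDen r ^ 2 -
        9547 * isoNum r ^ 2 * isoDen r ^ 3 + 3698 * isoNum r * isoDen r ^ 4 -
        100 * isoDen r ^ 5 := by
      simp only [quintic]; field_simp
    rw [e]
    simp only [isoNum, isoDen, critPoly]
    ring
  rw [hr, zero_mul] at this
  exact (mul_eq_zero.1 this).resolve_left (pow_ne_zero 5 h0)

theorem isoNum_div_isoDen_sub {r s : ℝ} (hr : critPoly r = 0) (hr0 : isoDen r ≠ 0)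
    (hs0 : isoDen s ≠ 0) : isoNum r / isoDen r - isoNum s / isoDen s =
      (s - r) ^ 2 * critQuot s r / (isoDen r * isoDen s) := by
  rw [div_sub_div _ _ hr0 hs0, ← isoNum_mul_isoDen_sub hr s]
  ring

/-- Near a critical point the error in the value is quadratic, so six decimals of `r` give about
eleven of the value. -/
theorem abs_isoNum_div_isoDen_sub_le {r s : ℝ} (hr : r ∈ Set.Icc (0 : ℝ) 1)
    (hs : s ∈ Set.Icc (0 : ℝ) 1) (h : critPoly r = 0) (hrs : |s - r| ≤ 1 / 10 ^ 6)
    (hq : |critQuot s r| ≤ 30) :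
    |isoNum r / isoDen r - isoNum s / isoDen s| ≤ 3 / 10 ^ 11 := by
  have hdr := isoDen_pos hr.1 hr.2
  have hds := isoDen_pos hs.1 hs.2
  rw [isoNum_div_isoDen_sub h hdr.ne' hds.ne', abs_div, abs_mul, abs_pow,
    abs_of_pos (mul_pos hdr hds)]
  calc |s - r| ^ 2 * |critQuot s r| / (isoDen r * isoDen s) ≤ |s - r| ^ 2 * |critQuot s r| :=
        div_le_self (by positivity)
          (one_le_mul_of_one_le_of_one_le (one_le_isoDen hr.1 hr.2) (one_le_isoDen hs.1 hs.2))
    _ ≤ (1 / 10 ^ 6) ^ 2 * 30 := by gcongr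
    _ ≤ 3 / 10 ^ 11 := by norm_num

theorem continuous_critPoly : Continuous critPoly := by
  unfold critPoly; fun_prop

theorem exists_critical_small : ∃ r : ℝ, 0.210708 ≤ r ∧ r ≤ 0.210709 ∧ critPoly r = 0 := by
  obtain ⟨r, hr, h⟩ := intermediate_value_Icc' (show (0.210708 : ℝ) ≤ 0.210709 by norm_num)
    continuous_critPoly.continuousOn (show (0 : ℝ) ∈ _ by constructor <;> norm_num [critPoly])
  exact ⟨r, hr.1, hr.2, h⟩

theorem exists_critical_large : ∃ r : ℝ, 0.805458 ≤ r ∧ r ≤ 0.805459 ∧ critPoly r = 0 := by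
  obtain ⟨r, hr, h⟩ := intermediate_value_Icc (show (0.805458 : ℝ) ≤ 0.805459 by norm_num)
    continuous_critPoly.continuousOn (show (0 : ℝ) ∈ _ by constructor <;> norm_num [critPoly])
  exact ⟨r, hr.1, hr.2, h⟩

theorem critQuot_small_bounds {s r : ℝ} (h0 : 0 ≤ s) (h1 : s ≤ 1) (hr0 : 0.210708 ≤ r)
    (hr1 : r ≤ 0.210709) : 0 ≤ critQuot s r ∧ critQuot s r ≤ 30 := by
  have r2 : r ^ 2 ≤ 0.0445 := by nlinarith
  have r2' : 0.0443 ≤ r ^ 2 := by nlinarith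
  have r3 : r ^ 3 ≤ 0.0094 := by nlinarith
  have r3' : 0.0093 ≤ r ^ 3 := by nlinarith
  have c0 : 10.4 ≤ 8 + 16 * r - 12 * r ^ 2 - 40 * r ^ 3 + 16 * r ^ 4 := by
    nlinarith [pow_pos (by linarith : 0 < r) 4]
  have c1 : 0 ≤ 4 - 10 * r - 28 * r ^ 2 + 16 * r ^ 3 := by nlinarith
  have c2 : -10.3 ≤ -8 - 12 * r + 8 * r ^ 2 := by nlinarith
  have c2' : -8 - 12 * r + 8 * r ^ 2 ≤ 0 := by nlinarith
  simp only [critQuot]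
  have s2 : s ^ 2 ≤ 1 := by nlinarith
  constructor
  · nlinarith [mul_nonneg c1 h0, mul_nonneg (sub_nonneg.2 c2) (sq_nonneg s)]
  · nlinarith [mul_nonneg c1 (sub_nonneg.2 h1), mul_nonneg (sub_nonneg.2 c2') (sq_nonneg s),
      pow_le_one₀ (n := 4) (by linarith : 0 ≤ r) (by linarith)]

theorem critQuot_large_bounds {s r : ℝ} (h0 : 0 ≤ s) (h1 : s ≤ 1) (hr0 : 0.805458 ≤ r)
    (hr1 : r ≤ 0.805459) : critQuot s r ≤ 0 ∧ -30 ≤ critQuot s r := by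
  have r2 : r ^ 2 ≤ 0.6488 := by nlinarith
  have r2' : 0.6487 ≤ r ^ 2 := by nlinarith
  have r3 : r ^ 3 ≤ 0.5226 := by nlinarith
  have r3' : 0.5225 ≤ r ^ 3 := by nlinarith
  have r4 : r ^ 4 ≤ 0.421 := by nlinarith
  have r4' : 0.4208 ≤ r ^ 4 := by nlinarith
  have c0 : 8 + 16 * r - 12 * r ^ 2 - 40 * r ^ 3 + 16 * r ^ 4 ≤ -1 := by linarith
  have c0' : -1.1 ≤ 8 + 16 * r - 12 * r ^ 2 - 40 * r ^ 3 + 16 * r ^ 4 := by linarith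
  have c1 : 4 - 10 * r - 28 * r ^ 2 + 16 * r ^ 3 ≤ 0 := by linarith
  have c1' : -14 ≤ 4 - 10 * r - 28 * r ^ 2 + 16 * r ^ 3 := by linarith
  have c2 : -8 - 12 * r + 8 * r ^ 2 ≤ 0 := by linarith
  have c2' : -13 ≤ -8 - 12 * r + 8 * r ^ 2 := by linarith
  have s2 : s ^ 2 ≤ 1 := by nlinarith
  simp only [critQuot]
  constructor
  · nlinarith [mul_nonneg (neg_nonneg.2 c1) h0, mul_nonneg (neg_nonneg.2 c2) (sq_nonneg s)]
  · nlinarith [mul_nonneg (sub_nonneg.2 c1') h0, mul_nonneg (sub_nonneg.2 c2') (sq_nonneg s)]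

/-- Between the two critical values and above them the quintic has no further root. -/
theorem quintic_root_eq_or_le {c₁ c₂ x : ℝ} (h1 : 0.9 ≤ c₁) (h2 : 1.1 ≤ c₂) (h12 : c₁ < c₂)
    (hc1 : quintic c₁ = 0) (hc2 : quintic c₂ = 0) (hx : quintic x = 0) : x = c₂ ∨ x ≤ c₁ := by
  by_contra! h
  obtain ⟨hne, hlt⟩ := h
  -- The last factor is the second divided difference of the quintic at `c₁, c₂, x`, which must
  -- vanish if all three are distinct roots.
  have e : (c₂ - c₁) * quintic x - (c₂ - x) * quintic c₁ - (x - c₁) * quintic c₂ =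
      (c₂ - c₁) * (x - c₁) * (x - c₂) * (6137 * (c₁ ^ 3 + c₂ ^ 3 + x ^ 3 + c₁ ^ 2 * c₂ + c₁ * c₂ ^ 2 +
        c₁ ^ 2 * x + c₁ * x ^ 2 + c₂ ^ 2 * x + c₂ * x ^ 2 + c₁ * c₂ * x) -
        14689 * (c₁ ^ 2 + c₂ ^ 2 + x ^ 2 + c₁ * c₂ + c₁ * x + c₂ * x) + 14429 * (c₁ + c₂ + x) -
        9547) := by
    simp only [quintic]; ring
  rw [hc1, hc2, hx, mul_zero, mul_zero, mul_zero, sub_zero, sub_zero] at e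
  have hpos : 0 < 6137 * (c₁ ^ 3 + c₂ ^ 3 + x ^ 3 + c₁ ^ 2 * c₂ + c₁ * c₂ ^ 2 +
        c₁ ^ 2 * x + c₁ * x ^ 2 + c₂ ^ 2 * x + c₂ * x ^ 2 + c₁ * c₂ * x) -
        14689 * (c₁ ^ 2 + c₂ ^ 2 + x ^ 2 + c₁ * c₂ + c₁ * x + c₂ * x) + 14429 * (c₁ + c₂ + x) -
        9547 := by
    -- Shifting to the lower bounds makes every coefficient positive.
    obtain ⟨u, rfl⟩ : ∃ u, c₁ = 0.9 + u := ⟨c₁ - 0.9, by ring⟩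
    obtain ⟨v, rfl⟩ : ∃ v, c₂ = 1.1 + v := ⟨c₂ - 1.1, by ring⟩
    obtain ⟨w, rfl⟩ : ∃ w, x = 0.9 + w := ⟨x - 0.9, by ring⟩
    have hu : 0 ≤ u := by linarith
    have hv : 0 ≤ v := by linarith
    have hw : 0 ≤ w := by linarith
    ring_nf
    positivity
  have := mul_ne_zero (mul_ne_zero (mul_ne_zero (sub_pos.2 h12).ne' (sub_pos.2 hlt).ne')
    (sub_ne_zero.2 hne)) hpos.ne'
  exact this e.symm

theorem six_seven_bounds : ∃ C₁ C₂ : ℝ,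
    IsGreatest {x : ℝ | quintic x = 0} C₂ ∧
    IsGreatest ({x : ℝ | quintic x = 0} \ {C₂}) C₁ ∧
    |C₁ - 0.9002270330| < 1 / 10 ^ 10 ∧
    |C₂ - 1.100851119| < 1 / 10 ^ 9 ∧
    BestBounds 3 6 7 C₁ C₂ := by
  obtain ⟨r₁, ha₁, hb₁, h₁⟩ := exists_critical_large
  obtain ⟨r₂, ha₂, hb₂, h₂⟩ := exists_critical_small
  have hr₁ : r₁ ∈ Set.Icc (0 : ℝ) 1 := ⟨by linarith, by linarith⟩
  have hr₂ : r₂ ∈ Set.Icc (0 : ℝ) 1 := ⟨by linarith, by linarith⟩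
  have hd₁ := isoDen_pos hr₁.1 hr₁.2
  have hd₂ := isoDen_pos hr₂.1 hr₂.2
  have q₁ := quintic_critical_value h₁ hd₁.ne'
  have q₂ := quintic_critical_value h₂ hd₂.ne'
  have bound₁ : |isoNum r₁ / isoDen r₁ - 0.9002270330| < 1 / 10 ^ 10 := by
    have hv := critQuot_large_bounds (s := 0.8054587) (by norm_num) (by norm_num) ha₁ hb₁
    have h1 := abs_isoNum_div_isoDen_sub_le hr₁ (s := 0.8054587)
      ⟨by norm_num, by norm_num⟩ h₁ (abs_le.2 ⟨by linarith, by linarith⟩)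
      (abs_le.2 ⟨hv.2, by linarith⟩)
    have hval : |isoNum 0.8054587 / isoDen 0.8054587 - 0.9002270330| < 4 / 10 ^ 11 := by
      norm_num [isoNum, isoDen, abs_lt]
    rw [abs_lt] at hval ⊢
    rw [abs_le] at h1
    constructor <;> linarith [hval.1, hval.2, h1.1, h1.2]
  have bound₂ : |isoNum r₂ / isoDen r₂ - 1.100851119| < 1 / 10 ^ 9 := by
    have hv := critQuot_small_bounds (s := 0.2107088) (by norm_num) (by norm_num) ha₂ hb₂
    have h1 := abs_isoNum_div_isoDen_sub_le hr₂ (s := 0.2107088)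
      ⟨by norm_num, by norm_num⟩ h₂ (abs_le.2 ⟨by linarith, by linarith⟩)
      (abs_le.2 ⟨by linarith, hv.2⟩)
    have hval : |isoNum 0.2107088 / isoDen 0.2107088 - 1.100851119| < 1 / 10 ^ 10 := by
      norm_num [isoNum, isoDen, abs_lt]
    rw [abs_lt] at hval ⊢
    rw [abs_le] at h1
    constructor <;> linarith [hval.1, hval.2, h1.1, h1.2]
  have l₁ := abs_lt.1 bound₁
  have l₂ := abs_lt.1 bound₂
  have hroot := fun x => quintic_root_eq_or_le (x := x) (by linarith) (by linarith) (by linarith)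
    q₁ q₂
  have iso : ∀ s ∈ Set.Icc (0 : ℝ) 1, isoDist 6 s = isoNum s / isoDen s * isoDist 7 s := by
    intro s hs
    have := hs.2
    have : 0 < 2 - s := by linarith
    have : 0 < 2 + s - 2 * s ^ 2 := by nlinarith [hs.1]
    simp only [isoDist, isoNum, isoDen]
    field_simp
  have pos7 : ∀ s ∈ Set.Icc (0 : ℝ) 1, 0 < isoDist 7 s := by
    intro s hs
    have := hs.2
    exact div_pos (by nlinarith [hs.1]) (by linarith)
  have iso₁ : ∀ s, 0 ≤ s → s ≤ 1 → isoNum r₁ / isoDen r₁ * isoDist 7 s ≤ 1 * isoDist 6 s := by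
    intro s h0 h1
    have hs := isoDen_pos h0 h1
    rw [iso s ⟨h0, h1⟩, one_mul]
    refine mul_le_mul_of_nonneg_right ?_ (pos7 s ⟨h0, h1⟩).le
    rw [← sub_nonpos, isoNum_div_isoDen_sub h₁ hd₁.ne' hs.ne']
    exact div_nonpos_of_nonpos_of_nonneg (mul_nonpos_of_nonneg_of_nonpos (sq_nonneg _)
      (critQuot_large_bounds h0 h1 ha₁ hb₁).1) (by positivity)
  have iso₂ : ∀ s, 0 ≤ s → s ≤ 1 → 1 * isoDist 6 s ≤ isoNum r₂ / isoDen r₂ * isoDist 7 s := by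
    intro s h0 h1
    have hs := isoDen_pos h0 h1
    rw [iso s ⟨h0, h1⟩, one_mul]
    refine mul_le_mul_of_nonneg_right ?_ (pos7 s ⟨h0, h1⟩).le
    rw [← sub_nonneg, isoNum_div_isoDen_sub h₂ hd₂.ne' hs.ne']
    have := (critQuot_small_bounds h0 h1 ha₂ hb₂).1
    positivity
  refine ⟨isoNum r₁ / isoDen r₁, isoNum r₂ / isoDen r₂, ⟨q₂, fun x hx => ?_⟩,
    ⟨⟨q₁, fun h => ?_⟩, fun x hx => (hroot x hx.1).resolve_left hx.2⟩, bound₁, bound₂, ?_, ?_⟩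
  · rcases hroot x hx with h | h <;> linarith
  · rw [Set.mem_singleton_iff] at h
    linarith
  · exact bestLower_of (by simp) (by simp)
      (mul_D_seven_le_six (by linarith) (by linarith) iso₁) r₁ hr₁ (pos7 r₁ hr₁) (iso r₁ hr₁).le
  · exact bestUpper_of (by simp) (by simp)
      (D_six_le_mul_seven (by linarith) iso₂) r₂ hr₂ (pos7 r₂ hr₂) (iso r₂ hr₂).ge

theorem bestLower_one_six : BestLower 3 1 6 (√3 - 1) := by
  have h3 : √3 ^ 2 = 3 := Real.sq_sqrt (by norm_num)
  have h1 : 1 ≤ √3 := Real.one_le_sqrt.2 (by norm_num)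
  have h2 : √3 ≤ 3 := by nlinarith
  refine bestLower_of (by simp) (by simp) mul_D_six_le_one ((√3 - 1) / 2)
    ⟨by linarith, by linarith⟩ ?_ (le_of_eq ?_)
  · have : 0 < 1 + 2 * ((√3 - 1) / 2) := by linarith
    simp only [isoDist]
    positivity
  · simp only [isoDist]
    rw [mul_div_assoc', eq_div_iff (by positivity)]
    linear_combination (-1 / 2) * h3

theorem bestLower_one_seven : BestLower 3 1 7 ((7 + 4 * √2) / 17) := by
  have h2 : √2 ^ 2 = 2 := Real.sq_sqrt (by norm_num)
  have h0 : 0 < √2 := by positivity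
  have h1 : 1 ≤ √2 := Real.one_le_sqrt.2 (by norm_num)
  have h3 : √2 ≤ 2 := by nlinarith
  have h4 : 2 + (2 - √2) - 2 * (2 - √2) ^ 2 = 7 * √2 - 8 := by linear_combination (-2) * h2
  have h5 : 2 - (2 - √2) = √2 := by ring
  refine bestLower_of (by simp) (by simp) mul_D_seven_le_one (2 - √2)
    ⟨by linarith, by linarith⟩ ?_ (le_of_eq ?_)
  · simp only [isoDist]
    rw [h4, h5]
    exact div_pos (by nlinarith) h0
  · simp only [isoDist]
    rw [h4, h5, mul_div_assoc', eq_div_iff h0.ne']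
    linear_combination (-28 / 17) * h2

end TriangleCenters

/-! ### Assembly of the table -/

theorem mainTheorem6 :
    BestBounds 3 1 2 1 3 ∧
    BestBounds 3 1 4 (1 / 3) 1 ∧
    BestBounds 3 1 5 (2 / 3) 2 ∧
    BestBounds 3 1 6 (√3 - 1) 1 ∧
    BestBounds 3 1 7 ((7 + 4 * √2) / 17) 1 ∧
    BestLowerOnly 3 1 8 1 ∧
    BestLowerOnly 3 1 9 1 ∧
    BestLowerOnly 3 1 10 1 ∧
    ((∀ T : Affine.Triangle ℝ Plane, D T 3 2 = 1 / 3 * D T 3 4) ∧ BestBounds 3 2 4 (1 / 3) (1 / 3)) ∧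
    ((∀ T : Affine.Triangle ℝ Plane, D T 3 2 = 2 / 3 * D T 3 5) ∧ BestBounds 3 2 5 (2 / 3) (2 / 3)) ∧
    BestBounds 3 2 6 (1 / 3) 1 ∧
    BestBounds 3 2 7 (1 / 3) 1 ∧
    BestLowerOnly 3 2 8 (1 / 3) ∧
    BestLowerOnly 3 2 9 1 ∧
    BestLowerOnly 3 2 10 1 ∧
    ((∀ T : Affine.Triangle ℝ Plane, D T 3 4 = 2 * D T 3 5) ∧ BestBounds 3 4 5 2 2) ∧
    BestBounds 3 4 6 1 3 ∧
    BestBounds 3 4 7 1 3 ∧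
    BestLowerOnly 3 4 8 1 ∧
    BestLowerOnly 3 4 9 3 ∧
    BestLowerOnly 3 4 10 3 ∧
    BestBounds 3 5 6 (1 / 2) (3 / 2) ∧
    BestBounds 3 5 7 (1 / 2) (3 / 2) ∧
    BestLowerOnly 3 5 8 (1 / 2) ∧
    BestLowerOnly 3 5 9 (3 / 2) ∧
    BestLowerOnly 3 5 10 (3 / 2) ∧
    (∃ C₁ C₂ : ℝ,
      IsGreatest {x : ℝ | quintic x = 0} C₂ ∧
      IsGreatest ({x : ℝ | quintic x = 0} \ {C₂}) C₁ ∧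
      |C₁ - 0.9002270330| < 1 / 10 ^ 10 ∧
      |C₂ - 1.100851119| < 1 / 10 ^ 9 ∧
      BestBounds 3 6 7 C₁ C₂) ∧
    BestLowerOnly 3 6 8 1 ∧
    BestLowerOnly 3 6 9 1 ∧
    BestLowerOnly 3 6 10 1 ∧
    BestLowerOnly 3 7 8 1 ∧
    BestLowerOnly 3 7 9 1 ∧
    BestLowerOnly 3 7 10 1 ∧
    BestLowerOnly 3 8 9 0 ∧
    BestLowerOnly 3 8 10 0 ∧
    BestBounds 3 9 10 (1 / 2) 1 := by
  have d4 := D_three_four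
  have d5 := D_three_five
  have b0 : ∀ T, 0 ≤ D T 3 8 := fun T => dist_nonneg
  have b1 := D_ten_le_two
  have b2 := D_two_le_one
  have b3 := D_one_le_six
  have b4 := D_one_le_seven
  have b5 := D_eight_le_one
  have b6 := D_nine_le_ten
  have b8 := D_six_le_two
  have b9 := D_seven_le_two
  refine ⟨?_, ?_, ?_, ?_, ?_, ?_, ?_, ?_, ?_, ?_, ?_, ?_, ?_, ?_, ?_, ?_, ?_, ?_, ?_, ?_,
    ?_, ?_, ?_, ?_, ?_, ?_, ?_, ?_, ?_, ?_, ?_, ?_, ?_, ?_, ?_, ?_⟩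
  -- Test shapes throughout: at `s = 1` the apex falls on the midpoint of the base; at `s = 0` the
  -- base shrinks to a point, and the entries for `X₉`, `X₁₀` vanish; `s = 1/2` is the equilateral
  -- limit, where the entry for `X₈` vanishes.
  · exact ⟨bestLower_of (by simp) (by simp) (fun T => by linarith [b2 T]) 1 (by norm_num)
      (by norm_num [isoDist]) (by norm_num [isoDist]),
      bestUpper_of (by simp) (by simp) (fun T => by linarith [b3 T, b8 T]) 0 (by norm_num)
      (by norm_num [isoDist]) (by norm_num [isoDist])⟩
  · exact ⟨bestLower_of (by simp) (by simp) (fun T => by linarith [d4 T, b2 T]) 1 (by norm_num)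
      (by norm_num [isoDist]) (by norm_num [isoDist]),
      bestUpper_of (by simp) (by simp) (fun T => by linarith [d4 T, b3 T, b8 T]) 0 (by norm_num)
      (by norm_num [isoDist]) (by norm_num [isoDist])⟩
  · exact ⟨bestLower_of (by simp) (by simp) (fun T => by linarith [d5 T, b2 T]) 1 (by norm_num)
      (by norm_num [isoDist]) (by norm_num [isoDist]),
      bestUpper_of (by simp) (by simp) (fun T => by linarith [d5 T, b3 T, b8 T]) 0 (by norm_num)
      (by norm_num [isoDist]) (by norm_num [isoDist])⟩
  · exact ⟨bestLower_one_six,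
      bestUpper_of (by simp) (by simp) (fun T => by linarith [b3 T]) 0 (by norm_num)
      (by norm_num [isoDist]) (by norm_num [isoDist])⟩
  · exact ⟨bestLower_one_seven,
      bestUpper_of (by simp) (by simp) (fun T => by linarith [b4 T]) 0 (by norm_num)
      (by norm_num [isoDist]) (by norm_num [isoDist])⟩
  · exact ⟨bestLower_of (by simp) (by simp) (fun T => by linarith [b5 T]) 1 (by norm_num)
      (by norm_num [isoDist]) (by norm_num [isoDist]),
      noUpper_of (by simp) (by simp) (1 / 2) (by norm_num) (by norm_num [isoDist])
      (by norm_num [isoDist])⟩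
  · exact ⟨bestLower_of (by simp) (by simp) (fun T => by linarith [b6 T, b1 T, b2 T]) 1 (by norm_num)
      (by norm_num [isoDist]) (by norm_num [isoDist]),
      noUpper_of (by simp) (by simp) 0 (by norm_num) (by norm_num [isoDist])
      (by norm_num [isoDist])⟩
  · exact ⟨bestLower_of (by simp) (by simp) (fun T => by linarith [b1 T, b2 T]) 1 (by norm_num)
      (by norm_num [isoDist]) (by norm_num [isoDist]),
      noUpper_of (by simp) (by simp) 0 (by norm_num) (by norm_num [isoDist])
      (by norm_num [isoDist])⟩
  · exact ⟨fun T => by linarith [d4 T],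
      bestLower_of (by simp) (by simp) (fun T => by linarith [d4 T]) 0 (by norm_num)
      (by norm_num [isoDist]) (by norm_num [isoDist]),
      bestUpper_of (by simp) (by simp) (fun T => by linarith [d4 T]) 0 (by norm_num)
      (by norm_num [isoDist]) (by norm_num [isoDist])⟩
  · exact ⟨fun T => by linarith [d5 T],
      bestLower_of (by simp) (by simp) (fun T => by linarith [d5 T]) 0 (by norm_num)
      (by norm_num [isoDist]) (by norm_num [isoDist]),
      bestUpper_of (by simp) (by simp) (fun T => by linarith [d5 T]) 0 (by norm_num)
      (by norm_num [isoDist]) (by norm_num [isoDist])⟩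
  · exact ⟨bestLower_of (by simp) (by simp) (fun T => by linarith [b8 T]) 0 (by norm_num)
      (by norm_num [isoDist]) (by norm_num [isoDist]),
      bestUpper_of (by simp) (by simp) (fun T => by linarith [b2 T, b3 T]) 1 (by norm_num)
      (by norm_num [isoDist]) (by norm_num [isoDist])⟩
  · exact ⟨bestLower_of (by simp) (by simp) (fun T => by linarith [b9 T]) 0 (by norm_num)
      (by norm_num [isoDist]) (by norm_num [isoDist]),
      bestUpper_of (by simp) (by simp) (fun T => by linarith [b2 T, b4 T]) 1 (by norm_num)
      (by norm_num [isoDist]) (by norm_num [isoDist])⟩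
  · exact ⟨bestLower_of (by simp) (by simp) (fun T => by linarith [b5 T, b3 T, b8 T]) 0 (by norm_num)
      (by norm_num [isoDist]) (by norm_num [isoDist]),
      noUpper_of (by simp) (by simp) (1 / 2) (by norm_num) (by norm_num [isoDist])
      (by norm_num [isoDist])⟩
  · exact ⟨bestLower_of (by simp) (by simp) (fun T => by linarith [b6 T, b1 T]) 1 (by norm_num)
      (by norm_num [isoDist]) (by norm_num [isoDist]),
      noUpper_of (by simp) (by simp) 0 (by norm_num) (by norm_num [isoDist])
      (by norm_num [isoDist])⟩
  · exact ⟨bestLower_of (by simp) (by simp) (fun T => by linarith [b1 T]) 1 (by norm_num)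
      (by norm_num [isoDist]) (by norm_num [isoDist]),
      noUpper_of (by simp) (by simp) 0 (by norm_num) (by norm_num [isoDist])
      (by norm_num [isoDist])⟩
  · exact ⟨fun T => by linarith [d4 T, d5 T],
      bestLower_of (by simp) (by simp) (fun T => by linarith [d4 T, d5 T]) 0 (by norm_num)
      (by norm_num [isoDist]) (by norm_num [isoDist]),
      bestUpper_of (by simp) (by simp) (fun T => by linarith [d4 T, d5 T]) 0 (by norm_num)
      (by norm_num [isoDist]) (by norm_num [isoDist])⟩
  · exact ⟨bestLower_of (by simp) (by simp) (fun T => by linarith [d4 T, b8 T]) 0 (by norm_num)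
      (by norm_num [isoDist]) (by norm_num [isoDist]),
      bestUpper_of (by simp) (by simp) (fun T => by linarith [d4 T, b2 T, b3 T]) 1 (by norm_num)
      (by norm_num [isoDist]) (by norm_num [isoDist])⟩
  · exact ⟨bestLower_of (by simp) (by simp) (fun T => by linarith [d4 T, b9 T]) 0 (by norm_num)
      (by norm_num [isoDist]) (by norm_num [isoDist]),
      bestUpper_of (by simp) (by simp) (fun T => by linarith [d4 T, b2 T, b4 T]) 1 (by norm_num)
      (by norm_num [isoDist]) (by norm_num [isoDist])⟩
  · exact ⟨bestLower_of (by simp) (by simp) (fun T => by linarith [d4 T, b5 T, b3 T, b8 T]) 0 (by norm_num)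
      (by norm_num [isoDist]) (by norm_num [isoDist]),
      noUpper_of (by simp) (by simp) (1 / 2) (by norm_num) (by norm_num [isoDist])
      (by norm_num [isoDist])⟩
  · exact ⟨bestLower_of (by simp) (by simp) (fun T => by linarith [d4 T, b6 T, b1 T]) 1 (by norm_num)
      (by norm_num [isoDist]) (by norm_num [isoDist]),
      noUpper_of (by simp) (by simp) 0 (by norm_num) (by norm_num [isoDist])
      (by norm_num [isoDist])⟩
  · exact ⟨bestLower_of (by simp) (by simp) (fun T => by linarith [d4 T, b1 T]) 1 (by norm_num)
      (by norm_num [isoDist]) (by norm_num [isoDist]),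
      noUpper_of (by simp) (by simp) 0 (by norm_num) (by norm_num [isoDist])
      (by norm_num [isoDist])⟩
  · exact ⟨bestLower_of (by simp) (by simp) (fun T => by linarith [d5 T, b8 T]) 0 (by norm_num)
      (by norm_num [isoDist]) (by norm_num [isoDist]),
      bestUpper_of (by simp) (by simp) (fun T => by linarith [d5 T, b2 T, b3 T]) 1 (by norm_num)
      (by norm_num [isoDist]) (by norm_num [isoDist])⟩
  · exact ⟨bestLower_of (by simp) (by simp) (fun T => by linarith [d5 T, b9 T]) 0 (by norm_num)
      (by norm_num [isoDist]) (by norm_num [isoDist]),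
      bestUpper_of (by simp) (by simp) (fun T => by linarith [d5 T, b2 T, b4 T]) 1 (by norm_num)
      (by norm_num [isoDist]) (by norm_num [isoDist])⟩
  · exact ⟨bestLower_of (by simp) (by simp) (fun T => by linarith [d5 T, b5 T, b3 T, b8 T]) 0 (by norm_num)
      (by norm_num [isoDist]) (by norm_num [isoDist]),
      noUpper_of (by simp) (by simp) (1 / 2) (by norm_num) (by norm_num [isoDist])
      (by norm_num [isoDist])⟩
  · exact ⟨bestLower_of (by simp) (by simp) (fun T => by linarith [d5 T, b6 T, b1 T]) 1 (by norm_num)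
      (by norm_num [isoDist]) (by norm_num [isoDist]),
      noUpper_of (by simp) (by simp) 0 (by norm_num) (by norm_num [isoDist])
      (by norm_num [isoDist])⟩
  · exact ⟨bestLower_of (by simp) (by simp) (fun T => by linarith [d5 T, b1 T]) 1 (by norm_num)
      (by norm_num [isoDist]) (by norm_num [isoDist]),
      noUpper_of (by simp) (by simp) 0 (by norm_num) (by norm_num [isoDist])
      (by norm_num [isoDist])⟩
  · exact six_seven_bounds
  · exact ⟨bestLower_of (by simp) (by simp) (fun T => by linarith [b5 T, b3 T]) 0 (by norm_num)
      (by norm_num [isoDist]) (by norm_num [isoDist]),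
      noUpper_of (by simp) (by simp) (1 / 2) (by norm_num) (by norm_num [isoDist])
      (by norm_num [isoDist])⟩
  · exact ⟨bestLower_of (by simp) (by simp) (fun T => by linarith [b6 T, b1 T, b2 T, b3 T]) 1 (by norm_num)
      (by norm_num [isoDist]) (by norm_num [isoDist]),
      noUpper_of (by simp) (by simp) 0 (by norm_num) (by norm_num [isoDist])
      (by norm_num [isoDist])⟩
  · exact ⟨bestLower_of (by simp) (by simp) (fun T => by linarith [b1 T, b2 T, b3 T]) 1 (by norm_num)
      (by norm_num [isoDist]) (by norm_num [isoDist]),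
      noUpper_of (by simp) (by simp) 0 (by norm_num) (by norm_num [isoDist])
      (by norm_num [isoDist])⟩
  · exact ⟨bestLower_of (by simp) (by simp) (fun T => by linarith [b5 T, b4 T]) 0 (by norm_num)
      (by norm_num [isoDist]) (by norm_num [isoDist]),
      noUpper_of (by simp) (by simp) (1 / 2) (by norm_num) (by norm_num [isoDist])
      (by norm_num [isoDist])⟩
  · exact ⟨bestLower_of (by simp) (by simp) (fun T => by linarith [b6 T, b1 T, b2 T, b4 T]) 1 (by norm_num)
      (by norm_num [isoDist]) (by norm_num [isoDist]),
      noUpper_of (by simp) (by simp) 0 (by norm_num) (by norm_num [isoDist])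
      (by norm_num [isoDist])⟩
  · exact ⟨bestLower_of (by simp) (by simp) (fun T => by linarith [b1 T, b2 T, b4 T]) 1 (by norm_num)
      (by norm_num [isoDist]) (by norm_num [isoDist]),
      noUpper_of (by simp) (by simp) 0 (by norm_num) (by norm_num [isoDist])
      (by norm_num [isoDist])⟩
  -- A best lower bound of 0 rules out every positive constant.
  · exact ⟨bestLower_of (by simp) (by simp) (fun T => by linarith [b0 T]) (1 / 2) (by norm_num)
      (by norm_num [isoDist]) (by norm_num [isoDist]),
      noUpper_of (by simp) (by simp) 0 (by norm_num) (by norm_num [isoDist])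
      (by norm_num [isoDist])⟩
  · exact ⟨bestLower_of (by simp) (by simp) (fun T => by linarith [b0 T]) (1 / 2) (by norm_num)
      (by norm_num [isoDist]) (by norm_num [isoDist]),
      noUpper_of (by simp) (by simp) 0 (by norm_num) (by norm_num [isoDist])
      (by norm_num [isoDist])⟩
  · exact ⟨bestLower_nine_ten,
      bestUpper_of (by simp) (by simp) (fun T => by linarith [b6 T]) 1 (by norm_num)
      (by norm_num [isoDist]) (by norm_num [isoDist])⟩
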